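/- **Definitions.** A binary $X\times Y$ matrix between totally ordered sets is a map $M:X\times Y\to\{0,1\}$ ($X$ indexes columns, $Y$ rows). A *division* of $M$ is a partition of $X$ into intervals together with a partition of $Y$ into intervals; its quotient matrix has a $1$ at a pair of parts exactly when the corresponding zone of $M$ contains a $1$. A *division sequence* of a finite matrix goes from the division into singletons to the trivial division, each step merging two parts of the column partition or two parts of the row partition; its width is the maximum number of $1$'s in a row or column of any of the quotient matrices. The *strict twin-width* $\mathrm{stww}(M)$ of a finite $M$ is the minimum width of a division sequence; for infinite $M$ it is the supremum over all finite submatrices. For a group $\Gamma$ acting on $X$ and a total order $<$ on $X$, let $M_g^{<}(x,y)=1$ iff $g$ maps $x$ to $y$. The *uniform twin-width* of the action is $\min_{<}\sup_{g\in\Gamma}\mathrm{stww}(M_g^{<})\in\mathbb N\cup\{\infty\}$, the minimum being over all total orders on $X$; $\mathrm{utww}(\Gamma)$ is the uniform twin-width of the action of $\Gamma$ on itself by right multiplication. For a subgroup $H\le G$, not necessarily normal, $\mathrm{utww}(G/H)$ in (0) below denotes the uniform twin-width of the action of $G$ by right multiplication on the set of right cosets $\{Hg\}$. **Lemma 1.5.**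 The following hold for arbitrary groups. - (0) For every subgroup $H\le G$: $\mathrm{utww}(G)\le\max(\mathrm{utww}(H),\mathrm{utww}(G/H))$. - (1) *Extensions.* If $1\to N\to E\to Q\to 1$ is exact, then $\mathrm{utww}(E)\le\max(\mathrm{utww}(N),\mathrm{utww}(Q))$. Moreover, for every semidirect product $G\rtimes H$, $\mathrm{utww}(G\rtimes H)=\max(\mathrm{utww}(G),\mathrm{utww}(H))$, and $\mathrm{utww}(G\times H)=\max(\mathrm{utww}(G),\mathrm{utww}(H))$. - (2) *Direct products and sums.* For every non-empty, possibly infinite family $(G_i)_{i\in I}$, $\mathrm{utww}\bigl(\prod_{i}G_i\bigr)=\mathrm{utww}\bigl(\bigoplus_i G_i\bigr)=\sup_{i}\mathrm{utww}(G_i)$, where $\bigoplus_i G_i$ is the subgroup of finitely supported families. - (3) *Direct limits.* If $G$ is the union of a directed family of subgroups $(G_i)_{i\in I}$, then $\mathrm{utww}(G)=\sup_{i}\mathrm{utww}(G_i)$. - (4) *Finite-index supergroups.* If $H\le G$ has finite index, then $\mathrm{utww}(H)\le\mathrm{utww}(G)\le\max(\mathrm{utww}(H),[G:H])$. - (5)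 *Quotients by finite normal subgroups.* There is a universal constant $C$ such that, for every group $G$ and every finite normal subgroup $N$ of order $t$: $\mathrm{utww}(G)$ is finite if and only if $\mathrm{utww}(G/N)$ is finite; $\mathrm{utww}(G)\le\max(\mathrm{utww}(G/N),t)$; if $t=1$ then $\mathrm{utww}(G/N)=\mathrm{utww}(G)$; and if $t\ge2$ and $\mathrm{utww}(G)=k<\infty$ then $\mathrm{utww}(G/N)\le 2^{t^{C t k}}$. - (6) *Wreath products.* Let $G\wr H=G^H\rtimes H$, where $h\in H$ acts on $x\in G^H$ by $(x\cdot h)(h')=x(h'h)$, and let $G\wr_r H$ be its subgroup $\bigl(\bigoplus_{h\in H}G\bigr)\rtimes H$. Then $\mathrm{utww}(G\wr H)=\mathrm{utww}(G\wr_r H)=\max(\mathrm{utww}(G),\mathrm{utww}(H))$. In particular each of these constructions preserves finiteness of uniform twin-width (in (2) and (3): provided the uniform twin-widths of the $G_i$ are bounded). -/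

import Mathlib

namespace TwinWidth

/-! ### Strict twin-width of matrices

A binary `X × Y` matrix between linearly ordered sets is a relation `M : X → Y → Prop`.
The elements of `X` are the column indices, those of `Y` the row indices. -/

section Matrix

/-- The maximum number of `1`-entries in a column or a row of a binary matrix. -/
noncomputable def maxDegree {X Y : Type*} (M : X → Y → Prop) : ℕ∞ :=
  max (⨆ x, {y | M x y}.encard) (⨆ y, {x | M x y}.encard)

/-- A division of an `X × Y` matrix: a partition of the columns and a partition of the rows,
all of whose parts are intervals. Partitions are given by equivalence relations. -/
@[ext]
structure Division (X Y : Type*) [LinearOrder X] [LinearOrder Y] where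
  /-- the partition of the set of columns -/
  cols : Setoid X
  /-- the partition of the set of rows -/
  rows : Setoid Y
  /-- the parts of the column partition are intervals -/
  cols_interval : ∀ x, {x' | cols x x'}.OrdConnected
  /-- the parts of the row partition are intervals -/
  rows_interval : ∀ y, {y' | rows y y'}.OrdConnected

/-- The partition `s` is obtained from the partition `r` by merging two distinct parts
(the part of `a` and the part of `b`). -/
def Merges {X : Type*} (r s : Setoid X) : Prop :=
  ∃ a b, ¬ r a b ∧ ∀ x y, s x y ↔ (r x y ∨ (r x a ∧ r y b) ∨ (r x b ∧ r y a))

variable {X Y : Type*} [LinearOrder X] [LinearOrder Y]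

/-- The division into singletons. -/
def Division.finest : Division X Y where
  cols := ⊥
  rows := ⊥
  cols_interval x := by
    have h : {x' : X | (⊥ : Setoid X) x x'} = {x} := by
      ext x'; simp [eq_comm]
    rw [h]; exact Set.ordConnected_singleton
  rows_interval y := by
    have h : {y' : Y | (⊥ : Setoid Y) y y'} = {y} := by
      ext y'; simp [eq_comm]
    rw [h]; exact Set.ordConnected_singleton

/-- The trivial division, with all columns in one part and all rows in one part. -/
def Division.trivial : Division X Y where
  cols := ⊤
  rows := ⊤
  cols_interval _ := by simpa [Setoid.top_def] using Set.ordConnected_univ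
  rows_interval _ := by simpa [Setoid.top_def] using Set.ordConnected_univ

/-- `E` is obtained from `D` by merging two parts, either two column parts or two row parts. -/
def Division.Step (D E : Division X Y) : Prop :=
  (Merges D.cols E.cols ∧ D.rows = E.rows) ∨ (D.cols = E.cols ∧ Merges D.rows E.rows)

/-- The quotient of a matrix by a division: a zone becomes a `1` if it contains some `1`. -/
def Division.quotientMatrix (D : Division X Y) (M : X → Y → Prop) :
    Quotient D.cols → Quotient D.rows → Prop :=
  fun P Q => ∃ x y, Quotient.mk D.cols x = P ∧ Quotient.mk D.rows y = Q ∧ M x y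

variable (X Y) in
/-- A division sequence: it starts at the division into singletons, ends at the trivial
division, and each division is obtained from the previous one by merging two parts. -/
structure DivisionSequence where
  /-- the sequence of divisions -/
  series : RelSeries {p : Division X Y × Division X Y | p.1.Step p.2}
  head_eq : series.head = Division.finest
  last_eq : series.last = Division.trivial

/-- The width of a division sequence for the matrix `M`: the maximum degree of a column or row
in the quotient matrices. -/
noncomputable def DivisionSequence.width (S : DivisionSequence X Y) (M : X → Y → Prop) : ℕ∞ :=
  ⨆ i : Fin (S.series.length + 1), maxDegree ((S.series i).quotientMatrix M)

/-- Strict twin-width of a finite matrix: the minimum width of a division sequence. -/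
noncomputable def stwwFinite (M : X → Y → Prop) : ℕ∞ :=
  ⨅ S : DivisionSequence X Y, S.width M

/-- Strict twin-width of a possibly infinite matrix: the supremum of the strict twin-width of
its finite submatrices. -/
noncomputable def stww (M : X → Y → Prop) : ℕ∞ :=
  ⨆ (A : Finset X) (B : Finset Y), stwwFinite (fun (a : A) (b : B) => M a b)

end Matrix

/-! ### Uniform twin-width -/

/-- The matrix of the action of `g` on `X`: its entry at `(x, y)` is `1` when `g` maps `x`
to `y`. -/
def actionMatrix {Γ X : Type*} [SMul Γ X] (g : Γ) (x y : X) : Prop := g • x = y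

/-- Uniform twin-width of an action with regards to a given total order. -/
noncomputable def utwwWithOrder (Γ X : Type*) [Group Γ] [MulAction Γ X] [LinearOrder X] : ℕ∞ :=
  ⨆ g : Γ, stww (actionMatrix g : X → X → Prop)

/-- Uniform twin-width of an action: the minimum over all total orders. A right action of `Γ`
is an action of `Γᵐᵒᵖ`. -/
noncomputable def utwwAction (Γ X : Type*) [Group Γ] [MulAction Γ X] : ℕ∞ :=
  ⨅ o : LinearOrder X, @utwwWithOrder Γ X _ _ o

/-- Uniform twin-width of a group: that of its action on itself by right product,
`MulOpposite.op g • x = x * g`. -/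
noncomputable def utww (Γ : Type*) [Group Γ] : ℕ∞ := utwwAction Γᵐᵒᵖ Γ

/-! ### Group constructions -/

/-- The set of right cosets `Hg` of a subgroup. -/
def RightCosets {G : Type*} [Group G] (H : Subgroup G) : Type _ :=
  Quotient (QuotientGroup.rightRel H)

/-- `G` acts on the right cosets of `H` by right product: `(Hx) · g = H(xg)`. -/
instance {G : Type*} [Group G] (H : Subgroup G) : MulAction Gᵐᵒᵖ (RightCosets H) where
  smul g := Quotient.map' (fun x => x * g.unop) (fun x y h => by
    rw [QuotientGroup.rightRel_apply] at h ⊢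
    simpa [mul_assoc] using h)
  one_smul q := by
    induction q using Quotient.inductionOn'
    exact congrArg (Quotient.mk _) (mul_one _)
  mul_smul g h q := by
    induction q using Quotient.inductionOn'
    exact congrArg (Quotient.mk _) (mul_assoc _ _ _).symm

/-- The direct sum of a family of groups: the subgroup of the direct product consisting of the
finitely supported families. -/
def directSum {ι : Type*} (G : ι → Type*) [∀ i, Group (G i)] : Subgroup (∀ i, G i) where
  carrier := {x | {i | x i ≠ 1}.Finite}
  one_mem' := by simp
  mul_mem' {x y} hx hy := by
    refine (Set.Finite.union hx hy).subset fun i hi => ?_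
    by_contra h
    simp only [Set.mem_union, Set.mem_ofPred_eq, not_or, not_not] at h
    exact hi (by simp [h.1, h.2])
  inv_mem' {x} hx := by simpa using hx

/-- The action of `H` on `H → G` by right product on indices: `(h · x)(h') = x(h'h)`. -/
def wreathHom (G H : Type*) [Group G] [Group H] : H →* MulAut (H → G) where
  toFun h :=
    { toFun := fun x h' => x (h' * h)
      invFun := fun x h' => x (h' * h⁻¹)
      left_inv := fun x => by ext; simp
      right_inv := fun x => by ext; simp
      map_mul' := fun _ _ => rfl }
  map_one' := by ext x h'; simp
  map_mul' h k := by ext x h'; simp [mul_assoc]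

/-- The complete wreath product `G ≀ H = G^H ⋊ H`. -/
abbrev WreathProduct (G H : Type*) [Group G] [Group H] : Type _ :=
  (H → G) ⋊[wreathHom G H] H

/-- The restricted wreath product, as the subgroup of the complete wreath product formed by the
elements whose component in `G^H` is in the direct sum. -/
def restrictedWreathProduct (G H : Type*) [Group G] [Group H] :
    Subgroup (WreathProduct G H) where
  carrier := {w | w.left ∈ directSum (fun _ : H => G)}
  one_mem' := (directSum (fun _ : H => G)).one_mem
  mul_mem' {v w} hv hw := by
    refine (directSum (fun _ : H => G)).mul_mem hv ?_
    exact Set.Finite.preimage (mul_left_injective v.right).injOn hw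
  inv_mem' {w} hw := by
    have h := (directSum (fun _ : H => G)).inv_mem hw
    exact Set.Finite.preimage (mul_left_injective w.right⁻¹).injOn h

end TwinWidth

universe u v w

namespace TwinWidth

open Relation

/-! ### Coarse division sequences -/

/-! A group element acts by a matrix with at most one `1` per row and column. Merges are grouped
into coarse steps (`BigStep`), in which each part of the new division sees at most `k` parts of the
old one on the other side. Every division between the two then has width at most `k`, so whole
families of blocks can be contracted at once.

For cosets, order `G` lexicographically, by coset and then by position in the coset. Right
multiplication permutes the cosets, so its matrix has at most one nonzero block in each row or
column of blocks, and each block is a multiplication matrix of `H`. Contract all blocks in parallel,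
then the matrix of blocks (`stwwFinite_le_of_fibers`, `utwwAction_le_of_fibration`). Extensions and
finite index follow; lower bounds come from restricting orders to subgroups.

Infinite constructions use locality (`utww_le_of_local`): an ultralimit of orders on local models
gives an order on the whole group. A subgroup of a directed union, or a finite subproduct, is such a
model.

For `G ⧸ N`, the matrix of an element is covered by `|N|` matrices coming from `G`. Bounded width
excludes large grids (`Contractible.not_hasGrid`), bipartite Ramsey carries this over to the union
(`HasGrid.of_union`), and the Marcus–Tardos argument bounds the number of ones linearly. Hence two
consecutive parts with few ones can always be merged (`Contractible.of_not_hasGrid`). -/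

/-- The number of classes of `r` which meet `S`. -/
noncomputable def classCount {Y : Type*} (r : Setoid Y) (S : Set Y) : ℕ∞ :=
  (Quotient.mk r '' S).encard

/-- Choosing one representative per class makes `φ` injective on classes as soon as it reflects the
relations; it need not preserve them. -/
lemma classCount_le {Y Y' : Type*} {r : Setoid Y} {r' : Setoid Y'} {S : Set Y} {S' : Set Y'}
    (φ : S → Y') (hφ : ∀ y, φ y ∈ S')
    (h : ∀ y₁ y₂ : S, r' (φ y₁) (φ y₂) → r y₁ y₂) : classCount r S ≤ classCount r' S' := by
  have hrep : ∀ q : (Quotient.mk r '' S), ∃ y : S, Quotient.mk r y = q := by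
    rintro ⟨_, y, hy, rfl⟩
    exact ⟨⟨y, hy⟩, rfl⟩
  choose ρ hρ using hrep
  let f : (Quotient.mk r '' S) → (Quotient.mk r' '' S') :=
    fun q => ⟨Quotient.mk r' (φ (ρ q)), _, hφ _, rfl⟩
  have hf : Function.Injective f := by
    intro q₁ q₂ hq
    have h1 : Quotient.mk r' (φ (ρ q₁)) = Quotient.mk r' (φ (ρ q₂)) := congrArg Subtype.val hq
    have h2 := h _ _ (Quotient.exact h1)
    exact Subtype.ext (by rw [← hρ q₁, ← hρ q₂]; exact Quotient.sound h2)
  exact Function.Embedding.encard_le ⟨f, hf⟩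

lemma classCount_mono {Y : Type*} {r r' : Setoid Y} {S S' : Set Y} (hr : r' ≤ r) (hS : S ⊆ S') :
    classCount r S ≤ classCount r' S' :=
  classCount_le (fun y => y) (fun y => hS y.2) fun _ _ h => hr h

lemma classCount_ker_le {Y Z : Type*} (g : Y → Z) (S : Set Y) :
    classCount (Setoid.ker g) S ≤ (g '' S).encard := by
  refine (classCount_le (r' := (⊥ : Setoid Z)) (S' := g '' S) (fun y => g y)
    (fun y => ⟨y, y.2, rfl⟩) fun _ _ h => h).trans ?_
  exact Set.encard_image_le _ _

/-- The rows with a `1` in the part of `x`. -/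
def colSupport {X Y : Type*} (M : X → Y → Prop) (r : Setoid X) (x : X) : Set Y := {y | ∃ x', r x x' ∧ M x' y}

/-- The columns with a `1` in the part of `y`. -/
def rowSupport {X Y : Type*} (M : X → Y → Prop) (r : Setoid Y) (y : Y) : Set X := {x | ∃ y', r y y' ∧ M x y'}

lemma colSupport_mono {X Y : Type*} (M : X → Y → Prop) {r s : Setoid X} (h : r ≤ s) (x : X) :
    colSupport M r x ⊆ colSupport M s x := fun _ ⟨x', h1, h2⟩ => ⟨x', h h1, h2⟩

lemma rowSupport_mono {X Y : Type*} (M : X → Y → Prop) {r s : Setoid Y} (h : r ≤ s) (y : Y) :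
    rowSupport M r y ⊆ rowSupport M s y := fun _ ⟨x', h1, h2⟩ => ⟨x', h h1, h2⟩

variable {X Y X' Y' : Type*} [LinearOrder X] [LinearOrder Y] [LinearOrder X'] [LinearOrder Y']

/-- A simultaneous coarsening from `D` to `E` in which each part of `E` sees at most `k` parts
of `D`. -/
structure BigStep (M : X → Y → Prop) (k : ℕ∞) (D E : Division X Y) : Prop where
  cols_le : D.cols ≤ E.cols
  rows_le : D.rows ≤ E.rows
  col_count : ∀ x, classCount D.rows (colSupport M E.cols x) ≤ k
  row_count : ∀ y, classCount D.cols (rowSupport M E.rows y) ≤ k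

/-- The counts compare new parts with old classes. Refining the former shrinks supports and
coarsening the latter identifies classes, so both changes can only lower the counts. -/
lemma BigStep.mono {M : X → Y → Prop} {k : ℕ∞} {D D₁ E₁ E : Division X Y} (h : BigStep M k D E)
    (hDc : D.cols ≤ D₁.cols) (hDr : D.rows ≤ D₁.rows)
    (hc : D₁.cols ≤ E₁.cols) (hr : D₁.rows ≤ E₁.rows)
    (hEc : E₁.cols ≤ E.cols) (hEr : E₁.rows ≤ E.rows) : BigStep M k D₁ E₁ where
  cols_le := hc
  rows_le := hr
  col_count x := (classCount_mono hDr (colSupport_mono M hEc x)).trans (h.col_count x)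
  row_count y := (classCount_mono hDc (rowSupport_mono M hEr y)).trans (h.row_count y)

lemma BigStep.right {M : X → Y → Prop} {k : ℕ∞} {D E : Division X Y} (h : BigStep M k D E) :
    BigStep M k E E := h.mono h.cols_le h.rows_le le_rfl le_rfl le_rfl le_rfl

lemma BigStep.left {M : X → Y → Prop} {k : ℕ∞} {D E : Division X Y} (h : BigStep M k D E) :
    BigStep M k D D := h.mono le_rfl le_rfl le_rfl le_rfl h.cols_le h.rows_le

lemma maxDegree_quotientMatrix_le_iff (M : X → Y → Prop) (k : ℕ∞) (D : Division X Y) :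
    maxDegree (D.quotientMatrix M) ≤ k ↔ BigStep M k D D := by
  have h1 : ∀ x, {Q | D.quotientMatrix M (Quotient.mk D.cols x) Q} =
      Quotient.mk D.rows '' colSupport M D.cols x := by
    intro x; ext Q; constructor
    · rintro ⟨x', y, hx, rfl, hM⟩
      exact ⟨y, ⟨x', Quotient.exact hx.symm, hM⟩, rfl⟩
    · rintro ⟨y, ⟨x', hx, hM⟩, rfl⟩
      exact ⟨x', y, (Quotient.sound hx).symm, rfl, hM⟩
  have h2 : ∀ y, {P | D.quotientMatrix M P (Quotient.mk D.rows y)} =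
      Quotient.mk D.cols '' rowSupport M D.rows y := by
    intro y; ext P; constructor
    · rintro ⟨x, y', rfl, hy, hM⟩
      exact ⟨x, ⟨y', Quotient.exact hy.symm, hM⟩, rfl⟩
    · rintro ⟨x, ⟨y', hy, hM⟩, rfl⟩
      exact ⟨x, y', rfl, (Quotient.sound hy).symm, hM⟩
  rw [maxDegree, max_le_iff, iSup_le_iff, iSup_le_iff]
  constructor
  · rintro ⟨hc, hr⟩
    refine ⟨le_rfl, le_rfl, fun x => ?_, fun y => ?_⟩
    · have := hc (Quotient.mk _ x); rw [h1] at this; exact this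
    · have := hr (Quotient.mk _ y); rw [h2] at this; exact this
  · intro h
    constructor
    · intro P
      induction P using Quotient.inductionOn with | h x => rw [h1]; exact h.col_count x
    · intro P
      induction P using Quotient.inductionOn with | h x => rw [h2]; exact h.row_count x

lemma Merges.le {Z : Type*} {r s : Setoid Z} (h : Merges r s) : r ≤ s := by
  obtain ⟨a, b, -, h⟩ := h
  intro x y hxy
  exact (h x y).2 (Or.inl hxy)

lemma Merges.ne {Z : Type*} {r s : Setoid Z} (h : Merges r s) : r ≠ s := by
  obtain ⟨a, b, hab, h⟩ := h
  rintro rfl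
  exact hab ((h a b).2 (Or.inr (Or.inl ⟨r.refl a, r.refl b⟩)))

/-- Between two partitions into intervals, there is a merge of two consecutive parts. -/
lemma exists_merges_le {Z : Type*} [LinearOrder Z] [Finite Z] {r s : Setoid Z}
    (hr : ∀ x, {x' | r x x'}.OrdConnected) (hs : ∀ x, {x' | s x x'}.OrdConnected)
    (hle : r ≤ s) (hne : r ≠ s) :
    ∃ t : Setoid Z, Merges r t ∧ t ≤ s ∧ ∀ x, {x' | t x x'}.OrdConnected := by
  have hr' : ∀ x y z, r x z → x ≤ y → y ≤ z → r x y := fun x y z h h1 h2 =>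
    (hr x).out (r.refl x) h ⟨h1, h2⟩
  have hs' : ∀ x y z, s x z → x ≤ y → y ≤ z → s x y := fun x y z h h1 h2 =>
    (hs x).out (s.refl x) h ⟨h1, h2⟩
  obtain ⟨a, b, hab, hsab, hrab⟩ : ∃ a b, a < b ∧ s a b ∧ ¬ r a b := by
    by_contra! hcon
    refine hne (le_antisymm hle fun {x y} hxy => ?_)
    rcases lt_trichotomy x y with h | rfl | h
    · exact hcon x y h hxy
    · exact r.refl x
    · exact r.symm (hcon y x h (s.symm hxy))
  -- `c` is the last element of the `r`-part of `a` and `d` its immediate successor, so their parts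
  -- are consecutive; `d ≤ b` keeps the merge inside `s`.
  obtain ⟨c, ⟨hca, hac⟩, hcmax⟩ := (Set.toFinite {z | r a z ∧ a ≤ z}).exists_maximal
    ⟨a, r.refl a, le_rfl⟩
  have hcb : c < b := by
    by_contra! h
    exact hrab (hr' a b c hca hab.le h)
  obtain ⟨d, hcd, hdmin⟩ := (Set.toFinite {z | c < z}).exists_minimal ⟨b, hcb⟩
  have hdb : d ≤ b := by
    by_contra! h
    exact absurd (hdmin hcb h.le) (not_le.2 h)
  have hcons : ∀ z, z ≤ c ∨ d ≤ z := by
    intro z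
    by_contra! h
    exact absurd (hdmin h.1 h.2.le) (not_le.2 h.2)
  have hrcd : ¬ r c d := by
    intro h
    have hd := hcmax (y := d) ⟨r.trans hca h, hac.trans (le_of_lt hcd)⟩ (le_of_lt hcd)
    exact absurd hd (not_le.2 hcd)
  have hscd : s c d :=
    hs' c d b (s.trans (s.symm (hle hca)) hsab) (le_of_lt hcd) hdb
  let t : Setoid Z :=
    { r := fun x y => r x y ∨ (r x c ∧ r y d) ∨ (r x d ∧ r y c)
      iseqv := ⟨fun x => Or.inl (r.refl x), by
        rintro x y (h | h | h)
        · exact Or.inl (r.symm h)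
        · exact Or.inr (Or.inr h.symm)
        · exact Or.inr (Or.inl h.symm), by
        rintro x y z (h | ⟨h, h'⟩ | ⟨h, h'⟩) (g | ⟨g, g'⟩ | ⟨g, g'⟩)
        · exact Or.inl (r.trans h g)
        · exact Or.inr (Or.inl ⟨r.trans h g, g'⟩)
        · exact Or.inr (Or.inr ⟨r.trans h g, g'⟩)
        · exact Or.inr (Or.inl ⟨h, r.trans (r.symm g) h'⟩)
        · exact absurd (r.trans (r.symm g) h') hrcd
        · exact Or.inl (r.trans h (r.symm g'))
        · exact Or.inr (Or.inr ⟨h, r.trans (r.symm g) h'⟩)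
        · exact Or.inl (r.trans h (r.symm g'))
        · exact absurd (r.trans (r.symm h') g) hrcd⟩ }
  have ht : ∀ x y, t x y ↔ (r x y ∨ (r x c ∧ r y d) ∨ (r x d ∧ r y c)) := fun _ _ => Iff.rfl
  have ht' : ∀ x y z, t x z → x ≤ y → y ≤ z → t x y := by
    intro x y z hxz hxy hyz
    rw [ht] at hxz ⊢
    rcases hxz with h | ⟨h, h'⟩ | ⟨h, h'⟩
    · exact Or.inl (hr' x y z h hxy hyz)
    · rcases hcons y with hy | hy
      · exact Or.inl (hr' x y c h hxy hy)
      · exact Or.inr (Or.inl ⟨h, r.symm (hr' d y z (r.symm h') hy hyz)⟩)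
    · exfalso
      rcases hcons x with hx | hx
      · exact hrcd (r.trans (r.symm (hr' x c d h hx (le_of_lt hcd))) h)
      · exact hrcd (hr' c d z (r.symm h') (le_of_lt hcd) (hx.trans (hxy.trans hyz)))
  refine ⟨t, ⟨c, d, hrcd, ht⟩, ?_, ?_⟩
  · rintro x y (h | ⟨h, h'⟩ | ⟨h, h'⟩)
    · exact hle h
    · exact s.trans (hle h) (s.trans hscd (s.symm (hle h')))
    · exact s.trans (hle h) (s.trans (s.symm hscd) (s.symm (hle h')))
  · intro x
    refine ⟨fun u hu v hv w hw => ?_⟩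
    exact t.trans hu (ht' u w v (t.trans (t.symm hu) hv) hw.1 hw.2)

/-- Makes strict coarsening well founded, so that repeated merging terminates. -/
instance {Z : Type*} [Finite Z] : Finite (Setoid Z) :=
  Finite.of_injective (fun r : Setoid Z => (fun x y => r x y : Z → Z → Prop))
    fun r s h => Setoid.ext fun x y => by
      have := congrFun (congrFun h x) y
      exact iff_of_eq this

/-- A merge between two divisions of small degree. -/
def GoodStep (M : X → Y → Prop) (k : ℕ∞) (D E : Division X Y) : Prop :=
  D.Step E ∧ BigStep M k E E

lemma BigStep.goodStep_cols [Finite X] {M : X → Y → Prop} {k : ℕ∞} {D E : Division X Y}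
    (h : BigStep M k D E) :
    ReflTransGen (GoodStep M k) D ⟨E.cols, D.rows, E.cols_interval, D.rows_interval⟩ := by
  obtain ⟨r, hr⟩ : ∃ r, r = D.cols := ⟨_, rfl⟩
  induction r using WellFoundedGT.induction generalizing D with
  | ind r ih =>
    subst hr
    by_cases hne : D.cols = E.cols
    · have : (⟨E.cols, D.rows, E.cols_interval, D.rows_interval⟩ : Division X Y) = D :=
        Division.ext hne.symm rfl
      rw [this]
    · obtain ⟨t, hm, htE, ht⟩ :=
        exists_merges_le D.cols_interval E.cols_interval h.cols_le hne
      let D' : Division X Y := ⟨t, D.rows, ht, D.rows_interval⟩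
      have h' : BigStep M k D' E := h.mono hm.le le_rfl htE h.rows_le le_rfl le_rfl
      exact ReflTransGen.head (b := D') ⟨Or.inl ⟨hm, rfl⟩, h'.left⟩
        (ih t (lt_of_le_of_ne hm.le hm.ne) h' rfl)

lemma BigStep.goodStep_rows [Finite Y] {M : X → Y → Prop} {k : ℕ∞} {D E : Division X Y}
    (h : BigStep M k D E) :
    ReflTransGen (GoodStep M k) D ⟨D.cols, E.rows, D.cols_interval, E.rows_interval⟩ := by
  obtain ⟨r, hr⟩ : ∃ r, r = D.rows := ⟨_, rfl⟩
  induction r using WellFoundedGT.induction generalizing D with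
  | ind r ih =>
    subst hr
    by_cases hne : D.rows = E.rows
    · have : (⟨D.cols, E.rows, D.cols_interval, E.rows_interval⟩ : Division X Y) = D :=
        Division.ext rfl hne.symm
      rw [this]
    · obtain ⟨t, hm, htE, ht⟩ :=
        exists_merges_le D.rows_interval E.rows_interval h.rows_le hne
      let D' : Division X Y := ⟨D.cols, t, D.cols_interval, ht⟩
      have h' : BigStep M k D' E := h.mono le_rfl hm.le h.cols_le htE le_rfl le_rfl
      exact ReflTransGen.head (b := D') ⟨Or.inr ⟨rfl, hm⟩, h'.left⟩
        (ih t (lt_of_le_of_ne hm.le hm.ne) h' rfl)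

/-- Merge the columns one pair at a time, then the rows; `BigStep.mono` controls every intermediate
division. -/
lemma BigStep.goodStep [Finite X] [Finite Y] {M : X → Y → Prop} {k : ℕ∞} {D E : Division X Y}
    (h : BigStep M k D E) : ReflTransGen (GoodStep M k) D E := by
  refine h.goodStep_cols.trans (BigStep.goodStep_rows (E := E) ?_)
  exact h.mono h.cols_le le_rfl le_rfl h.rows_le le_rfl le_rfl

/-- A coarse division sequence of width at most `k`. -/
def Contractible (M : X → Y → Prop) (k : ℕ∞) : Prop :=
  BigStep M k Division.finest Division.finest ∧
    ReflTransGen (BigStep M k) Division.finest Division.trivial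

lemma Contractible.stwwFinite_le [Finite X] [Finite Y] {M : X → Y → Prop} {k : ℕ∞}
    (h : Contractible M k) : stwwFinite M ≤ k := by
  have h1 : ReflTransGen (GoodStep M k) Division.finest Division.trivial := by
    obtain ⟨-, h⟩ := h
    generalize (Division.trivial : Division X Y) = E at h
    induction h with
    | refl => exact .refl
    | tail _ h ih => exact ih.trans h.goodStep
  have h2 : ∀ E, ReflTransGen (GoodStep M k) Division.finest E →
      ∃ s : RelSeries {p : Division X Y × Division X Y | p.1.Step p.2},
        s.head = Division.finest ∧ s.last = E ∧ ∀ D ∈ s, BigStep M k D D := by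
    intro E hE
    induction hE with
    | refl => exact ⟨.singleton _ _, rfl, rfl, by rintro D ⟨i, rfl⟩; exact h.1⟩
    | tail _ hs ih =>
      obtain ⟨s, hh, hl, hg⟩ := ih
      refine ⟨s.snoc _ (hl ▸ hs.1), by simpa using hh, by simp, ?_⟩
      intro D hD
      rcases RelSeries.mem_snoc.1 hD with hD | rfl
      · exact hg D hD
      · exact hs.2
  obtain ⟨s, hh, hl, hg⟩ := h2 _ h1
  refine iInf_le_of_le ⟨s, hh, hl⟩ (iSup_le fun i => ?_)
  rw [maxDegree_quotientMatrix_le_iff]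
  exact hg _ ⟨i, rfl⟩

lemma bigStep_top (M : X → Y → Prop) {D E : Division X Y} (hc : D.cols ≤ E.cols)
    (hr : D.rows ≤ E.rows) : BigStep M ⊤ D E := ⟨hc, hr, fun _ => le_top, fun _ => le_top⟩

lemma Division.Step.le {D E : Division X Y} (h : D.Step E) : D.cols ≤ E.cols ∧ D.rows ≤ E.rows := by
  rcases h with ⟨h, h'⟩ | ⟨h, h'⟩
  · exact ⟨h.le, h'.le⟩
  · exact ⟨h.le, h'.le⟩

/-- A merge leaves one side unchanged, so each mixed count is an ordinary degree of either `D` or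
`E`. -/
lemma GoodStep.bigStep {M : X → Y → Prop} {k : ℕ∞} {D E : Division X Y} (h : D.Step E)
    (hD : BigStep M k D D) (hE : BigStep M k E E) : BigStep M k D E := by
  refine ⟨h.le.1, h.le.2, fun x => ?_, fun y => ?_⟩
  · rcases h with ⟨h, h'⟩ | ⟨h, h'⟩
    · rw [h']; exact hE.col_count x
    · rw [← h]; exact hD.col_count x
  · rcases h with ⟨h, h'⟩ | ⟨h, h'⟩
    · rw [← h']; exact hD.row_count y
    · rw [h]; exact hE.row_count y

lemma contractible_of_stwwFinite_le [Finite X] [Finite Y] {M : X → Y → Prop} {k : ℕ∞}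
    (h : stwwFinite M ≤ k) : Contractible M k := by
  -- The infimum is attained only if some division sequence exists; one is obtained by refining the
  -- step from finest to trivial with the bound `⊤`.
  have hne : Nonempty (DivisionSequence X Y) := by
    by_contra hcon
    rw [not_nonempty_iff] at hcon
    have h0 : ∃ s : RelSeries {p : Division X Y × Division X Y | p.1.Step p.2},
        s.head = Division.finest ∧ s.last = Division.trivial := by
      have h1 := (bigStep_top M (D := .finest) (E := .trivial) bot_le bot_le).goodStep
      generalize (Division.trivial : Division X Y) = E at h1
      induction h1 with
      | refl => exact ⟨.singleton _ _, rfl, rfl⟩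
      | tail _ hs ih =>
        obtain ⟨s, hh, hl⟩ := ih
        exact ⟨s.snoc _ (hl ▸ hs.1), by simpa using hh, by simp⟩
    obtain ⟨s, hh, hl⟩ := h0
    exact hcon.false ⟨s, hh, hl⟩
  obtain ⟨S, hS⟩ := ciInf_mem (fun S : DivisionSequence X Y => S.width M)
  have hw : S.width M ≤ k := hS.le.trans h
  have hg : ∀ i, BigStep M k (S.series i) (S.series i) := fun i => by
    rw [← maxDegree_quotientMatrix_le_iff]
    exact (le_iSup (fun i => maxDegree ((S.series i).quotientMatrix M)) i).trans hw
  refine ⟨by rw [← S.head_eq]; exact hg 0, ?_⟩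
  have hpath : ∀ i : Fin (S.series.length + 1),
      ReflTransGen (BigStep M k) Division.finest (S.series i) := by
    intro i
    induction i using Fin.induction with
    | zero => rw [← S.head_eq]; exact .refl
    | succ i ih => exact ih.tail (GoodStep.bigStep (S.series.step i) (hg _) (hg _))
  rw [← S.last_eq]
  exact hpath _

end TwinWidth

namespace TwinWidth

open Relation

/-- Finitely many indices `p x` occur, each with at most one partner, so only finitely many block
lengths matter: all blocks are finished at a common time. -/
lemma exists_uniform_bound {X I K : Type*} [Finite X] (p : X → I) {M' : I → K → Prop}
    (hfun : ∀ i j j', M' i j → M' i j' → j = j') (n : ∀ i j, M' i j → ℕ) :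
    ∃ N, ∀ x i j (h : M' i j), p x = i → n i j h ≤ N := by
  have h1 : ∀ x, ∃ N, ∀ j (h : M' (p x) j), n _ _ h ≤ N := by
    intro x
    by_cases hx : ∃ j, M' (p x) j
    · obtain ⟨j, hj⟩ := hx
      refine ⟨n _ _ hj, fun j' h' => ?_⟩
      obtain rfl := hfun _ _ _ hj h'
      exact le_rfl
    · exact ⟨0, fun j h => absurd ⟨j, h⟩ hx⟩
  choose N hN using h1
  obtain ⟨B, hB⟩ := (Set.finite_range N).bddAbove
  refine ⟨B, ?_⟩
  rintro x _ j h rfl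
  exact (hN x j h).trans (hB ⟨x, rfl⟩)

variable {X Y X' Y' : Type*} [LinearOrder X] [LinearOrder Y] [LinearOrder X'] [LinearOrder Y']

/-! ### Restrictions and blocks -/

lemma ordConnected_of_rel {Z : Type*} [LinearOrder Z] {r : Setoid Z}
    (h : ∀ x y z, r x z → x ≤ y → y ≤ z → r x y) (x : Z) : {x' | r x x'}.OrdConnected :=
  ⟨fun u hu v hv w hw => r.trans hu (h u w v (r.trans (r.symm hu) hv) hw.1 hw.2)⟩

lemma rel_of_ordConnected {Z : Type*} [LinearOrder Z] {r : Setoid Z}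
    (h : ∀ x, {x' | r x x'}.OrdConnected) {x y z : Z} (hxz : r x z) (h1 : x ≤ y) (h2 : y ≤ z) :
    r x y :=
  (h x).out (r.refl x) hxz ⟨h1, h2⟩

/-- The pullback of a division along monotone maps. -/
def Division.comap {f : X → X'} {g : Y → Y'} (hf : Monotone f) (hg : Monotone g)
    (D : Division X' Y') : Division X Y where
  cols := D.cols.comap f
  rows := D.rows.comap g
  cols_interval := ordConnected_of_rel fun _ _ _ h h1 h2 =>
    rel_of_ordConnected D.cols_interval h (hf h1) (hf h2)
  rows_interval := ordConnected_of_rel fun _ _ _ h h1 h2 =>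
    rel_of_ordConnected D.rows_interval h (hg h1) (hg h2)

lemma BigStep.comap {f : X → X'} {g : Y → Y'} (hf : Monotone f) (hg : Monotone g)
    {M : X → Y → Prop} {M' : X' → Y' → Prop} (hM : ∀ x y, M x y → M' (f x) (g y)) {k : ℕ∞}
    {D E : Division X' Y'} (h : BigStep M' k D E) : BigStep M k (D.comap hf hg) (E.comap hf hg) where
  cols_le := fun _ _ hxy => h.cols_le hxy
  rows_le := fun _ _ hxy => h.rows_le hxy
  col_count x := (classCount_le (r' := D.rows) (S' := colSupport M' E.cols (f x))
    (fun y => g y) (fun y => by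
      obtain ⟨_, x', hx', hm⟩ := y
      exact ⟨f x', hx', hM _ _ hm⟩) fun _ _ h => h).trans (h.col_count (f x))
  row_count y := (classCount_le (r' := D.cols) (S' := rowSupport M' E.rows (g y))
    (fun x => f x) (fun x => by
      obtain ⟨_, y', hy', hm⟩ := x
      exact ⟨g y', hy', hM _ _ hm⟩) fun _ _ h => h).trans (h.row_count (g y))

lemma Contractible.comap {f : X → X'} {g : Y → Y'} (hf : StrictMono f) (hg : StrictMono g)
    {M : X → Y → Prop} {M' : X' → Y' → Prop} (hM : ∀ x y, M x y → M' (f x) (g y)) {k : ℕ∞}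
    (h : Contractible M' k) : Contractible M k := by
  have h0 : (Division.finest : Division X' Y').comap hf.monotone hg.monotone = .finest :=
    Division.ext (Setoid.ext fun _ _ => hf.injective.eq_iff)
      (Setoid.ext fun _ _ => hg.injective.eq_iff)
  have h1 := h.1.comap hf.monotone hg.monotone hM
  have h2 : ReflTransGen (BigStep M k) (Division.finest.comap hf.monotone hg.monotone)
      (Division.trivial.comap hf.monotone hg.monotone) :=
    h.2.lift (p := BigStep M k) (Division.comap hf.monotone hg.monotone)
    fun _ _ h => h.comap hf.monotone hg.monotone hM
  rw [h0] at h1 h2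
  exact ⟨h1, h2⟩

lemma stwwFinite_le_stwwFinite [Finite X] [Finite Y] [Finite X'] [Finite Y'] {f : X → X'}
    {g : Y → Y'} (hf : StrictMono f) (hg : StrictMono g)
    {M : X → Y → Prop} {M' : X' → Y' → Prop} (hM : ∀ x y, M x y → M' (f x) (g y)) :
    stwwFinite M ≤ stwwFinite M' :=
  ((contractible_of_stwwFinite_le le_rfl).comap hf hg hM).stwwFinite_le

lemma stwwFinite_le_stww [Finite X] [Finite Y] {f : X → X'}
    {g : Y → Y'} (hf : StrictMono f) (hg : StrictMono g)
    {M : X → Y → Prop} {M' : X' → Y' → Prop} (hM : ∀ x y, M x y → M' (f x) (g y)) :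
    stwwFinite M ≤ stww M' := by
  classical
  cases nonempty_fintype X
  cases nonempty_fintype Y
  refine le_trans ?_ (le_iSup₂ (Finset.univ.image f) (Finset.univ.image g))
  exact stwwFinite_le_stwwFinite
    (f := fun x => (⟨f x, by simp⟩ : {z // z ∈ Finset.univ.image f}))
    (g := fun y => (⟨g y, by simp⟩ : {z // z ∈ Finset.univ.image g}))
    (fun _ _ h => hf h) (fun _ _ h => hg h) hM

/-- Making the path stationary at its end lets paths of different lengths run on a common clock. -/
lemma exists_sequence_of_path {M : X → Y → Prop} {k : ℕ∞} {D E : Division X Y}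
    (h : ReflTransGen (BigStep M k) D E) (hD : BigStep M k D D) :
    ∃ (C : ℕ → Division X Y) (n : ℕ), C 0 = D ∧ (∀ t, n ≤ t → C t = E) ∧
      ∀ t, BigStep M k (C t) (C (t + 1)) := by
  induction h using ReflTransGen.head_induction_on with
  | refl => exact ⟨fun _ => E, 0, rfl, fun _ _ => rfl, fun _ => hD⟩
  | @head D D' h _ ih =>
    obtain ⟨C, n, h0, hn, hs⟩ := ih h.right
    refine ⟨fun t => Nat.casesOn t D C, n + 1, rfl, ?_, ?_⟩
    · rintro (_ | t) ht
      · omega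
      · exact hn t (by omega)
    · rintro (_ | t)
      · show BigStep M k D (C 0)
        rw [h0]; exact h
      · exact hs t

lemma path_of_sequence {M : X → Y → Prop} {k : ℕ∞} {C : ℕ → Division X Y}
    (h : ∀ t, BigStep M k (C t) (C (t + 1))) (n : ℕ) :
    ReflTransGen (BigStep M k) (C 0) (C n) := by
  induction n with
  | zero => exact .refl
  | succ n ih => exact ih.tail (h n)

variable {I J : Type*} [LinearOrder I] [LinearOrder J]

/-- The partition of `X` which refines the fibers of `p` by given partitions of the fibers, with
singletons at time zero. -/
def fiberSetoid {K : Type*} (p : X → I) (M' : I → K → Prop) (t : ℕ)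
    (C : ∀ i j, M' i j → Setoid {x // p x = i}) : Setoid X where
  -- A fiber without partner carries no partition to constrain it. The clause at `t = 0` makes it
  -- start as singletons; it collapses at time one.
  r x x' := p x = p x' ∧ (t = 0 → x = x') ∧
    ∀ i j (h : M' i j) (hx : p x = i), ∃ hx', C i j h ⟨x, hx⟩ ⟨x', hx'⟩
  iseqv := by
    refine ⟨fun x => ⟨rfl, fun _ => rfl, fun i j h hx => ⟨hx, (C i j h).refl _⟩⟩, ?_, ?_⟩
    · rintro x y ⟨h1, h2, h3⟩
      refine ⟨h1.symm, fun ht => (h2 ht).symm, fun i j h hy => ⟨h1.trans hy, ?_⟩⟩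
      obtain ⟨hy', h⟩ := h3 i j h (h1.trans hy)
      exact Setoid.symm' _ h
    · rintro x y z ⟨h1, h2, h3⟩ ⟨g1, g2, g3⟩
      refine ⟨h1.trans g1, fun ht => (h2 ht).trans (g2 ht), fun i j h hx => ?_⟩
      obtain ⟨hy, h4⟩ := h3 i j h hx
      obtain ⟨hz, h5⟩ := g3 i j h hy
      exact ⟨hz, Setoid.trans' _ h4 h5⟩

lemma fiberSetoid_ordConnected {K : Type*} {p : X → I} (hp : Monotone p) (M' : I → K → Prop)
    (t : ℕ) (C : ∀ i j, M' i j → Setoid {x // p x = i})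
    (hC : ∀ i j (h : M' i j) x, {x' | C i j h x x'}.OrdConnected) (x : X) :
    {x' | fiberSetoid p M' t C x x'}.OrdConnected := by
  refine ordConnected_of_rel ?_ x
  rintro x y z ⟨h1, h2, h3⟩ hxy hyz
  have hpy : p x = p y := le_antisymm (hp hxy) (h1 ▸ hp hyz)
  refine ⟨hpy, fun ht => le_antisymm hxy (h2 ht ▸ hyz), fun i j h hx => ?_⟩
  obtain ⟨hz, h4⟩ := h3 i j h hx
  exact ⟨hpy ▸ hx, rel_of_ordConnected (hC i j h) h4 hxy hyz⟩

/-- If a matrix has at most one nonzero block in each row and column of blocks, its strict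
twin-width is bounded by that of the blocks and that of the matrix of blocks. -/
theorem stwwFinite_le_of_fibers [Finite X] [Finite Y] {p : X → I} {q : Y → J}
    (hp : Monotone p) (hq : Monotone q) {M : X → Y → Prop} {M' : I → J → Prop}
    (hM : ∀ x y, M x y → M' (p x) (q y))
    (hfun : ∀ i j j', M' i j → M' i j' → j = j') (hinj : ∀ i i' j, M' i j → M' i' j → i = i')
    {k : ℕ∞} (hk : stww M' ≤ k)
    (hblock : ∀ i j, M' i j →
      stwwFinite (fun (x : {x // p x = i}) (y : {y // q y = j}) => M x y) ≤ k) :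
    stwwFinite M ≤ k := by
  -- `F` is the halfway point: the blocks contract on the way to it, the matrix of blocks after it.
  let F : Division X Y := ⟨Setoid.ker p, Setoid.ker q,
    ordConnected_of_rel fun x y z h h1 h2 => le_antisymm (hp h1)
      ((hp h2).trans_eq (show p z = p x from Eq.symm h)),
    ordConnected_of_rel fun x y z h h1 h2 => le_antisymm (hq h1)
      ((hq h2).trans_eq (show q z = q x from Eq.symm h))⟩
  have phase2 : ReflTransGen (BigStep M k) F Division.trivial := by
    have h1 : Contractible (fun (i : Set.range p) (j : Set.range q) => M' i j) k :=
      contractible_of_stwwFinite_le ((stwwFinite_le_stww (f := Subtype.val) (g := Subtype.val)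
        (fun _ _ h => h) (fun _ _ h => h) fun _ _ h => h).trans hk)
    have hp' : Monotone (Set.rangeFactorization p) := fun _ _ h => hp h
    have hq' : Monotone (Set.rangeFactorization q) := fun _ _ h => hq h
    have h2 : ReflTransGen (BigStep M k) (Division.finest.comap hp' hq')
        (Division.trivial.comap hp' hq') :=
      h1.2.lift (p := BigStep M k) (Division.comap hp' hq') fun _ _ h => h.comap hp' hq' hM
    have h3 : Division.finest.comap hp' hq' = F :=
      Division.ext (Setoid.ext fun _ _ => Subtype.ext_iff) (Setoid.ext fun _ _ => Subtype.ext_iff)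
    rwa [h3] at h2
  have hseq := fun i j h => exists_sequence_of_path
    (contractible_of_stwwFinite_le (hblock i j h)).2 (contractible_of_stwwFinite_le (hblock i j h)).1
  choose C n hC0 hCn hCs using hseq
  let D : ℕ → Division X Y := fun t =>
    ⟨fiberSetoid p M' t fun i j h => (C i j h t).cols,
      fiberSetoid q (fun j i => M' i j) t fun j i h => (C i j h t).rows,
      fiberSetoid_ordConnected hp _ _ _ fun i j h => (C i j h t).cols_interval,
      fiberSetoid_ordConnected hq _ _ _ fun j i h => (C i j h t).rows_interval⟩
  have hD0 : D 0 = Division.finest := by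
    refine Division.ext (Setoid.ext fun x x' => ⟨fun h => h.2.1 rfl, ?_⟩)
      (Setoid.ext fun x x' => ⟨fun h => h.2.1 rfl, ?_⟩)
    · rintro rfl; exact (D 0).cols.refl x
    · rintro rfl; exact (D 0).rows.refl x
  obtain ⟨N₁, hN₁⟩ := exists_uniform_bound p hfun n
  obtain ⟨N₂, hN₂⟩ := exists_uniform_bound q (M' := fun j i => M' i j)
    (fun j i i' h h' => hinj i i' j h h') (fun j i h => n i j h)
  -- The `+ 1` makes the time nonzero, which switches off the singleton clause of `fiberSetoid`.
  have hDn : D (max N₁ N₂ + 1) = F := by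
    refine Division.ext (Setoid.ext fun x x' => ⟨fun h => h.1, fun h => ⟨h, ?_, ?_⟩⟩)
      (Setoid.ext fun x x' => ⟨fun h => h.1, fun h => ⟨h, ?_, ?_⟩⟩)
    · intro h0; omega
    · intro i j hij hx
      refine ⟨(show p x = p x' from h) ▸ hx, ?_⟩
      have hc := hCn i j hij (max N₁ N₂ + 1) ((hN₁ x i j hij hx).trans (by omega))
      show (C i j hij (max N₁ N₂ + 1)).cols _ _
      rw [hc]
      trivial
    · intro h0; omega
    · intro j i hij hx
      refine ⟨(show q x = q x' from h) ▸ hx, ?_⟩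
      have hc := hCn i j hij (max N₁ N₂ + 1) ((hN₂ x j i hij hx).trans (by omega))
      show (C i j hij (max N₁ N₂ + 1)).rows _ _
      rw [hc]
      trivial
  have hDs : ∀ t, BigStep M k (D t) (D (t + 1)) := by
    intro t
    refine ⟨?_, ?_, fun x => ?_, fun y => ?_⟩
    · rintro x x' ⟨h1, h2, h3⟩
      refine ⟨h1, fun h0 => by omega, fun i j h hx => ?_⟩
      obtain ⟨hx', h4⟩ := h3 i j h hx
      exact ⟨hx', (hCs i j h t).cols_le h4⟩
    · rintro x x' ⟨h1, h2, h3⟩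
      refine ⟨h1, fun h0 => by omega, fun i j h hx => ?_⟩
      obtain ⟨hx', h4⟩ := h3 i j h hx
      exact ⟨hx', (hCs j i h t).rows_le h4⟩
    -- A nonempty support lies in a single fiber by `hfun`, so its count is the one made in the
    -- sequence of that block.
    · rcases (colSupport M (D (t + 1)).cols x).eq_empty_or_nonempty with h0 | ⟨y₀, x₀, hx₀, hm₀⟩
      · simp [h0, classCount]
      have h : M' (p x) (q y₀) := hx₀.1 ▸ hM _ _ hm₀
      have hq0 : ∀ y ∈ colSupport M (D (t + 1)).cols x, q y = q y₀ := by
        rintro y ⟨x', hx', hm⟩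
        exact hfun (p x) _ _ (hx'.1 ▸ hM _ _ hm) h
      refine le_trans (classCount_le (fun y => ⟨y, hq0 y y.2⟩) ?_ ?_)
        ((hCs _ _ h t).col_count ⟨x, rfl⟩)
      · rintro ⟨y, x', hx', hm⟩
        obtain ⟨h5, h6⟩ := hx'.2.2 _ _ h rfl
        exact ⟨⟨x', h5⟩, h6, hm⟩
      · rintro ⟨y₁, hy₁⟩ ⟨y₂, hy₂⟩ hr
        refine ⟨(hq0 _ hy₁).trans (hq0 _ hy₂).symm, ?_, ?_⟩
        · rintro rfl
          rw [hC0] at hr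
          have hr' : (⟨y₁, _⟩ : {y // q y = q y₀}) = ⟨y₂, _⟩ := hr
          simpa using hr'
        · rintro j i hij hj
          obtain rfl : j = q y₀ := hj.symm.trans (hq0 _ hy₁)
          obtain rfl : i = p x := hinj _ _ _ hij h
          exact ⟨hq0 _ hy₂, hr⟩
    · rcases (rowSupport M (D (t + 1)).rows y).eq_empty_or_nonempty with h0 | ⟨x₀, y₀, hy₀, hm₀⟩
      · simp [h0, classCount]
      have h : M' (p x₀) (q y) := hy₀.1 ▸ hM _ _ hm₀
      have hp0 : ∀ x ∈ rowSupport M (D (t + 1)).rows y, p x = p x₀ := by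
        rintro x ⟨y', hy', hm⟩
        exact hinj _ _ (q y) (hy'.1 ▸ hM _ _ hm) h
      refine le_trans (classCount_le (fun x => ⟨x, hp0 x x.2⟩) ?_ ?_)
        ((hCs _ _ h t).row_count ⟨y, rfl⟩)
      · rintro ⟨x, y', hy', hm⟩
        obtain ⟨h5, h6⟩ := hy'.2.2 _ _ h rfl
        exact ⟨⟨y', h5⟩, h6, hm⟩
      · rintro ⟨x₁, hx₁⟩ ⟨x₂, hx₂⟩ hr
        refine ⟨(hp0 _ hx₁).trans (hp0 _ hx₂).symm, ?_, ?_⟩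
        · rintro rfl
          rw [hC0] at hr
          have hr' : (⟨x₁, _⟩ : {x // p x = p x₀}) = ⟨x₂, _⟩ := hr
          simpa using hr'
        · rintro i j hij hi
          obtain rfl : i = p x₀ := hi.symm.trans (hp0 _ hx₁)
          obtain rfl : j = q y := hfun _ _ _ hij h
          exact ⟨hp0 _ hx₂, hr⟩
  refine Contractible.stwwFinite_le ⟨?_, ?_⟩
  · rw [← hD0]; exact (hDs 0).left
  · refine ReflTransGen.trans ?_ phase2
    rw [← hDn, ← hD0]
    exact path_of_sequence hDs _

end TwinWidth

namespace TwinWidth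

open Filter

/-! ### Uniform twin-width of actions -/

section Action

variable {Γ X : Type*} [Group Γ] [MulAction Γ X]

lemma exists_linearOrder_utwwWithOrder_eq (Γ X : Type*) [Group Γ] [MulAction Γ X] :
    ∃ o : LinearOrder X, @utwwWithOrder Γ X _ _ o = utwwAction Γ X := by
  classical
  have : Nonempty (LinearOrder X) := ⟨linearOrderOfSTO WellOrderingRel⟩
  exact ciInf_mem fun o : LinearOrder X => @utwwWithOrder Γ X _ _ o

lemma stwwFinite_le_utwwWithOrder [LinearOrder X] {P Q : Type*} [LinearOrder P] [LinearOrder Q]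
    [Finite P] [Finite Q] {M : P → Q → Prop} (g : Γ) {f : P → X} {f' : Q → X} (hf : StrictMono f)
    (hf' : StrictMono f') (hM : ∀ x y, M x y → g • f x = f' y) :
    stwwFinite M ≤ utwwWithOrder Γ X :=
  (stwwFinite_le_stww (M' := actionMatrix g) hf hf' hM).trans
    (le_iSup (fun g : Γ => stww (actionMatrix g : X → X → Prop)) g)

lemma utwwAction_le [LinearOrder X] {k : ℕ∞}
    (h : ∀ (g : Γ) (A B : Finset X), stwwFinite (fun (a : A) (b : B) => g • (a : X) = b) ≤ k) :
    utwwAction Γ X ≤ k :=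
  iInf_le_of_le _ (iSup_le fun g => iSup₂_le fun A B => h g A B)

/-- With the order pulled back along `f`, each matrix of the first action is a submatrix of one of
the second. -/
lemma utwwAction_le_of_injective {Γ' X' : Type*} [Group Γ'] [MulAction Γ' X'] (f : X → X')
    (hf : Function.Injective f) (φ : Γ → Γ') (h : ∀ g x, f (g • x) = φ g • f x) :
    utwwAction Γ X ≤ utwwAction Γ' X' := by
  obtain ⟨o, ho⟩ := exists_linearOrder_utwwWithOrder_eq Γ' X'
  let : LinearOrder X := LinearOrder.lift' f hf
  rw [← ho]
  refine utwwAction_le fun g A B => ?_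
  refine stwwFinite_le_utwwWithOrder (φ g) (f := fun a : A => f a) (f' := fun b : B => f b)
    (fun _ _ h => h) (fun _ _ h => h) fun x y hxy => ?_
  rw [← h, hxy]

/-- The uniform twin-width of an action which fibers over another one, the fibers being
identified with a fixed set up to a third action. -/
theorem utwwAction_le_of_fibration {Γ₁ Γ₂ I K : Type*} [Group Γ₁] [Group Γ₂] [MulAction Γ₁ I]
    [MulAction Γ₂ K] (p : X → I) (h : X → K) (hinj : Function.Injective fun x => (p x, h x))
    (φ : Γ → Γ₁) (hφ : ∀ (g : Γ) x, p (g • x) = φ g • p x)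
    (hfib : ∀ (g : Γ) i, ∃ γ : Γ₂, ∀ x : X, p x = i → h (g • x) = γ • h x) :
    utwwAction Γ X ≤ max (utwwAction Γ₂ K) (utwwAction Γ₁ I) := by
  obtain ⟨oI, hoI⟩ := exists_linearOrder_utwwWithOrder_eq Γ₁ I
  obtain ⟨oK, hoK⟩ := exists_linearOrder_utwwWithOrder_eq Γ₂ K
  -- The lexicographic order makes the fibers of `p` intervals, each ordered as a subset of `K`.
  let : LinearOrder X := LinearOrder.lift' (fun x => toLex (p x, h x)) hinj
  have hlt : ∀ x y : X, x < y ↔ p x < p y ∨ p x = p y ∧ h x < h y := fun x y =>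
    Prod.Lex.toLex_lt_toLex
  have hp : Monotone p := by
    intro x y hxy
    rcases hxy.lt_or_eq with hxy | rfl
    · rcases (hlt x y).1 hxy with h | h
      · exact h.le
      · exact h.1.le
    · exact le_rfl
  have hh : ∀ x y, p x = p y → x < y → h x < h y := by
    intro x y hxy hlt'
    rcases (hlt x y).1 hlt' with h | h
    · exact absurd h (hxy ▸ lt_irrefl _)
    · exact h.2
  rw [← hoI, ← hoK]
  refine utwwAction_le fun g A B => ?_
  refine stwwFinite_le_of_fibers (p := fun a : A => p a) (q := fun b : B => p b)
    (M' := actionMatrix (φ g)) (fun _ _ h => hp h) (fun _ _ h => hp h) ?_ ?_ ?_ ?_ ?_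
  · intro x y hxy
    rw [actionMatrix, ← hφ, hxy]
  · intro i j j' h1 h2
    exact h1.symm.trans h2
  · intro i i' j h1 h2
    exact MulAction.injective (φ g) (h1.trans h2.symm)
  · exact le_max_of_le_right (le_iSup (fun g : Γ₁ => stww (actionMatrix g : I → I → Prop)) (φ g))
  · intro i j _
    -- `γ` may vary with the fiber, because each block is contracted by its own sequence.
    obtain ⟨γ, hγ⟩ := hfib g i
    refine le_max_of_le_left (stwwFinite_le_utwwWithOrder γ
      (f := fun x : {x : A // p x = i} => h x) (f' := fun y : {y : B // p y = j} => h y)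
      (fun x y hxy => hh _ _ (x.2.trans y.2.symm) hxy)
      (fun x y hxy => hh _ _ (x.2.trans y.2.symm) hxy) fun x y hxy => ?_)
    rw [← hγ _ x.2, hxy]

end Action

/-! ### Subgroups, cosets, extensions and directed unions -/

section Group

variable {G G' : Type*} [Group G] [Group G']

lemma utww_le_of_injective (f : G →* G') (hf : Function.Injective f) : utww G ≤ utww G' :=
  utwwAction_le_of_injective f hf (fun g => MulOpposite.op (f g.unop)) fun g x => by simp

lemma utww_congr (e : G ≃* G') : utww G = utww G' :=
  le_antisymm (utww_le_of_injective e.toMonoidHom e.injective)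
    (utww_le_of_injective e.symm.toMonoidHom e.symm.injective)

lemma utww_subgroup_le (H : Subgroup G) : utww H ≤ utww G :=
  utww_le_of_injective H.subtype H.subtype_injective

lemma one_le_utww (G : Type*) [Group G] : 1 ≤ utww G := by
  obtain ⟨o, ho⟩ := exists_linearOrder_utwwWithOrder_eq Gᵐᵒᵖ G
  rw [utww, ← ho]
  have h := contractible_of_stwwFinite_le (stwwFinite_le_utwwWithOrder (X := G) (1 : Gᵐᵒᵖ)
    (f := fun _ : Unit => (1 : G)) (f' := fun _ : Unit => (1 : G)) (M := fun _ _ => True)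
    (fun _ _ h => absurd h (lt_irrefl _)) (fun _ _ h => absurd h (lt_irrefl _))
    (fun _ _ _ => by simp))
  refine le_trans ?_ (h.1.col_count ())
  refine Set.one_le_encard_iff_nonempty.2 ?_
  exact ⟨_, (), ⟨(), rfl, trivial⟩, rfl⟩

/-- Write `x = h * r` with `r` the chosen representative of its coset. If `r'` represents the coset
of `x * g`, then `h` becomes `h * (r * g * r'⁻¹)`: a right multiplication in `H` depending only on
`g` and the coset. -/
theorem utww_le_max_cosets (H : Subgroup G) :
    utww G ≤ max (utww H) (utwwAction Gᵐᵒᵖ (RightCosets H)) := by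
  let p : G → RightCosets H := Quotient.mk (QuotientGroup.rightRel H)
  have hp : ∀ x y, p x = p y ↔ y * x⁻¹ ∈ H := fun x y =>
    Quotient.eq.trans QuotientGroup.rightRel_apply
  have hmem : ∀ x, x * (Quotient.out (p x))⁻¹ ∈ H := fun x =>
    (hp _ _).1 (Quotient.out_eq (p x))
  refine utwwAction_le_of_fibration (Γ₂ := (H)ᵐᵒᵖ) p
    (fun x => (⟨x * (Quotient.out (p x))⁻¹, hmem x⟩ : H)) ?_ id (fun g x => rfl) ?_
  · intro x y hxy
    have h1 : p x = p y := (Prod.ext_iff.1 hxy).1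
    have h2 : x * (Quotient.out (p x))⁻¹ = y * (Quotient.out (p y))⁻¹ :=
      Subtype.ext_iff.1 (Prod.ext_iff.1 hxy).2
    rw [h1] at h2
    exact mul_right_cancel h2
  · intro g i
    have h1 : Quotient.out i * g.unop * (Quotient.out (g • i))⁻¹ ∈ H := by
      rw [← hp]
      refine (Quotient.out_eq (g • i)).trans ?_
      conv_lhs => rw [← Quotient.out_eq i]
      rfl
    refine ⟨MulOpposite.op ⟨_, h1⟩, ?_⟩
    rintro x rfl
    refine Subtype.ext ?_
    have h2 : p (x * g.unop) = g • p x := rfl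
    simp [h2, mul_assoc]

/-- The projection to `Q` embeds the right cosets of the image of `N` equivariantly, which turns the
coset bound into this one. -/
theorem utww_extension_le {N E Q : Type*} [Group N] [Group E] [Group Q]
    (S : GroupExtension N E Q) : utww E ≤ max (utww N) (utww Q) := by
  refine (utww_le_max_cosets S.inl.range).trans (max_le_max ?_ ?_)
  · exact (utww_congr (MonoidHom.ofInjective S.inl_injective)).ge
  · have hk : ∀ x y : E, S.rightHom x = S.rightHom y ↔ y * x⁻¹ ∈ S.inl.range := by
      intro x y
      rw [S.range_inl_eq_ker_rightHom, MonoidHom.mem_ker, map_mul, map_inv, mul_inv_eq_one,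
        eq_comm]
    let f : RightCosets S.inl.range → Q := Quotient.lift S.rightHom fun x y h =>
      (hk x y).2 (QuotientGroup.rightRel_apply.1 h)
    refine utwwAction_le_of_injective f ?_ (fun g => MulOpposite.op (S.rightHom g.unop)) ?_
    · intro a b
      induction a using Quotient.inductionOn with | h x
      induction b using Quotient.inductionOn with | h y
      intro h
      exact Quotient.sound (QuotientGroup.rightRel_apply.2 ((hk x y).1 h))
    · intro g a
      induction a using Quotient.inductionOn with | h x
      exact map_mul S.rightHom x g.unop

theorem utww_semidirectProduct {G H : Type*} [Group G] [Group H] (φ : H →* MulAut G) :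
    utww (G ⋊[φ] H) = max (utww G) (utww H) :=
  le_antisymm (utww_extension_le (SemidirectProduct.toGroupExtension φ))
    (max_le (utww_le_of_injective _ SemidirectProduct.inl_injective)
      (utww_le_of_injective _ SemidirectProduct.inr_injective))

theorem utww_prod (G H : Type*) [Group G] [Group H] :
    utww (G × H) = max (utww G) (utww H) := by
  rw [← utww_congr (SemidirectProduct.mulEquivProd (N := G) (G := H)), utww_semidirectProduct]

/-- Uniform twin-width is determined by finite pieces of the multiplication table. -/
theorem utww_le_of_local.{x, y} {G : Type x} [Group G] {k : ℕ∞}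
    (h : ∀ S : Finset G, ∃ (Q : Type y) (_ : Group Q) (f : G → Q), Set.InjOn f S ∧
      (∀ x ∈ S, ∀ g ∈ S, x * g ∈ S → f (x * g) = f x * f g) ∧ utww Q ≤ k) : utww G ≤ k := by
  classical
  choose Q hQ f hinj hmul hk using h
  choose o ho using fun S => exists_linearOrder_utwwWithOrder_eq (Q S)ᵐᵒᵖ (Q S)
  -- `U` refines the filter of large finite sets; the order on `G` is the limit along `U` of the
  -- orders pulled back by the `f S`.
  let U : Ultrafilter (Finset G) := Ultrafilter.of atTop
  have hU : ∀ T : Finset G, ∀ᶠ S in U, T ⊆ S := fun T =>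
    Ultrafilter.of_le atTop (eventually_ge_atTop T)
  let : LinearOrder G :=
    { le := fun x y => ∀ᶠ S in U, f S x ≤ f S y
      le_refl := fun x => Eventually.of_forall fun S => le_rfl
      le_trans := fun x y z h1 h2 => by filter_upwards [h1, h2] with S using le_trans
      le_antisymm := fun x y h1 h2 => by
        obtain ⟨S, h1, h2, h3⟩ := (h1.and (h2.and (hU {x, y}))).exists
        exact hinj S (h3 (by simp)) (h3 (by simp)) (le_antisymm h1 h2)
      le_total := fun x y => by
        rw [← Ultrafilter.eventually_or]
        exact Eventually.of_forall fun S => le_total _ _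
      toDecidableLE := Classical.decRel _ }
  have hle : ∀ x y : G, ∀ᶠ S in U, x ≤ y ↔ f S x ≤ f S y := by
    intro x y
    by_cases hxy : x ≤ y
    · filter_upwards [show ∀ᶠ S in U, f S x ≤ f S y from hxy] with S hS
      simp [hxy, hS]
    · filter_upwards [Ultrafilter.eventually_not.2 hxy] with S hS
      simp [hxy, hS]
  refine utwwAction_le fun g A B => ?_
  -- A finite submatrix involves finitely many comparisons, so one `S` realizes all of them and
  -- contains the entries and `g`.
  have h1 : ∀ᶠ S in U, ∀ x ∈ A ∪ B, ∀ y ∈ A ∪ B, (x ≤ y ↔ f S x ≤ f S y) :=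
    (Finset.eventually_all _).2 fun x _ => (Finset.eventually_all _).2 fun y _ => hle x y
  obtain ⟨S, hS, hsub⟩ := (h1.and (hU (insert g.unop (A ∪ B)))).exists
  have hlt : ∀ x ∈ A ∪ B, ∀ y ∈ A ∪ B, x < y → f S x < f S y := fun x hx y hy hxy =>
    lt_of_not_ge fun h => not_le_of_gt hxy ((hS y hy x hx).2 h)
  have hA : ∀ x ∈ A, x ∈ S := fun x hx => hsub (by simp [hx])
  have hB : ∀ x ∈ B, x ∈ S := fun x hx => hsub (by simp [hx])
  have hg : g.unop ∈ S := hsub (by simp)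
  refine le_trans ?_ (hk S)
  rw [utww, ← ho S]
  refine stwwFinite_le_utwwWithOrder (MulOpposite.op (f S g.unop)) (f := fun a : A => f S a)
    (f' := fun b : B => f S b) (fun x y hxy => hlt _ (by simp) _ (by simp) hxy)
    (fun x y hxy => hlt _ (by simp) _ (by simp) hxy) fun x y hxy => ?_
  have hxy' : (x : G) * g.unop = y := hxy
  change f S x * f S g.unop = f S y
  rw [← hmul S _ (hA _ x.2) _ hg (hxy' ▸ hB _ y.2), hxy']

/-- By directedness a finite set lies in a single `K j`, which serves as its local model; elements
outside are sent to `1`. -/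
theorem utww_union {ι : Type*} (K : ι → Subgroup G) (hK : Directed (· ≤ ·) K)
    (hG : ∀ g : G, ∃ i, g ∈ K i) : utww G = ⨆ i, utww (K i) := by
  classical
  refine le_antisymm (utww_le_of_local fun S => ?_) (iSup_le fun i => utww_subgroup_le _)
  have : Nonempty ι := ⟨(hG 1).choose⟩
  choose i hi using hG
  obtain ⟨j, hj⟩ := hK.finset_le (S.image i)
  have hS : ∀ x ∈ S, x ∈ K j := fun x hx => hj _ (Finset.mem_image_of_mem i hx) (hi x)
  refine ⟨K j, inferInstance, fun x => if h : x ∈ K j then ⟨x, h⟩ else 1, ?_, ?_,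
    le_iSup (fun i => utww (K i)) j⟩
  · intro x hx y hy hxy
    simpa [hS x hx, hS y hy] using hxy
  · intro x hx g hg hxg
    simp [hS x hx, hS g hg, (K j).mul_mem (hS x hx) (hS g hg)]

lemma utww_le_of_subsingleton [Subsingleton G] (G' : Type*) [Group G'] : utww G ≤ utww G' :=
  utww_le_of_injective (1 : G →* G') (Function.injective_of_subsingleton _)

end Group

/-! ### Direct products and direct sums -/

section Pi

variable {ι : Type*} (G : ι → Type*) [∀ i, Group (G i)]

lemma utww_pi_finset_le [Nonempty ι] (F : Finset ι) :
    utww (∀ i : F, G i) ≤ ⨆ i, utww (G i) := by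
  classical
  induction F using Finset.induction_on with
  | empty =>
    exact (utww_le_of_subsingleton (G (Classical.arbitrary ι))).trans (le_iSup (fun i => utww (G i)) _)
  | insert a F _ ih =>
    let f : (∀ i : (insert a F : Finset ι), G i) →* G a × (∀ i : F, G i) :=
      { toFun := fun x => (x ⟨a, by simp⟩, fun i => x ⟨i, by simp⟩)
        map_one' := rfl
        map_mul' := fun _ _ => rfl }
    have hf : Function.Injective f := by
      intro x y hxy
      obtain ⟨h1, h2⟩ := Prod.ext_iff.1 hxy
      ext ⟨i, hi⟩
      rcases Finset.mem_insert.1 hi with rfl | hi'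
      · exact h1
      · exact congrFun h2 ⟨i, hi'⟩
    refine (utww_le_of_injective f hf).trans ?_
    rw [utww_prod]
    exact max_le (le_iSup (fun i => utww (G i)) a) ih

/-- Finitely many families are separated by finitely many coordinates, and the projection to those
is a local model. -/
theorem utww_pi_le [Nonempty ι] : utww (∀ i, G i) ≤ ⨆ i, utww (G i) := by
  classical
  refine utww_le_of_local fun S => ?_
  have hdiff : ∀ x y : ∀ i, G i, ∃ i, x ≠ y → x i ≠ y i := by
    intro x y
    by_cases h : x = y
    · exact ⟨Classical.arbitrary ι, fun h' => absurd h h'⟩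
    · obtain ⟨i, hi⟩ := Function.ne_iff.1 h
      exact ⟨i, fun _ => hi⟩
  choose d hd using hdiff
  let F : Finset ι := (S ×ˢ S).image fun z => d z.1 z.2
  refine ⟨∀ i : F, G i, inferInstance, fun x i => x i, ?_, fun _ _ _ _ _ => rfl,
    utww_pi_finset_le G F⟩
  intro x hx y hy hxy
  by_contra hne
  exact hd x y hne (congrFun hxy ⟨d x y, Finset.mem_image.2 ⟨(x, y), by simpa using ⟨hx, hy⟩, rfl⟩⟩)

theorem utww_directSum [Nonempty ι] : utww (directSum G) = ⨆ i, utww (G i) := by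
  classical
  refine le_antisymm ((utww_subgroup_le _).trans (utww_pi_le G)) (iSup_le fun i => ?_)
  have h : ∀ x : G i, MonoidHom.mulSingle G i x ∈ directSum G := fun x =>
    (Set.finite_singleton i).subset fun j hj => by
      by_contra hne
      exact hj (Pi.mulSingle_eq_of_ne hne x)
  refine utww_le_of_injective ((MonoidHom.mulSingle G i).codRestrict _ h) fun x y hxy => ?_
  exact Pi.mulSingle_injective i (Subtype.ext_iff.1 hxy)

theorem utww_pi [Nonempty ι] : utww (∀ i, G i) = ⨆ i, utww (G i) :=
  le_antisymm (utww_pi_le G) ((utww_directSum G).ge.trans (utww_subgroup_le _))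

end Pi

/-! ### Wreath products -/

section Wreath

variable (G H : Type*) [Group G] [Group H]

theorem utww_wreathProduct : utww (WreathProduct G H) = max (utww G) (utww H) := by
  rw [utww_semidirectProduct, utww_pi, ciSup_const]

theorem utww_restrictedWreathProduct :
    utww (restrictedWreathProduct G H) = max (utww G) (utww H) := by
  refine le_antisymm ((utww_subgroup_le _).trans (utww_wreathProduct G H).le) (max_le ?_ ?_)
  · have h : utww (directSum fun _ : H => G) = utww G := by rw [utww_directSum, ciSup_const]
    rw [← h]
    let f : directSum (fun _ : H => G) →* restrictedWreathProduct G H :=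
      (SemidirectProduct.inl.comp (directSum fun _ : H => G).subtype).codRestrict _ fun x => x.2
    refine utww_le_of_injective f fun x y hxy => ?_
    exact Subtype.ext (SemidirectProduct.inl_injective (Subtype.ext_iff.1 hxy))
  · let f : H →* restrictedWreathProduct G H :=
      (SemidirectProduct.inr : H →* WreathProduct G H).codRestrict _ fun x =>
        (directSum fun _ : H => G).one_mem
    exact utww_le_of_injective f fun x y hxy =>
      SemidirectProduct.inr_injective (Subtype.ext_iff.1 hxy)

end Wreath

/-! ### Finite actions and subgroups of finite index -/

section Finite

lemma classCount_le_card {Y : Type*} (r : Setoid Y) (S : Set Y) : classCount r S ≤ ENat.card Y :=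
  ((Set.encard_image_le _ _).trans (Set.encard_le_encard (Set.subset_univ S))).trans_eq
    (Set.encard_univ Y)

lemma stwwFinite_le_card {X Y : Type*} [LinearOrder X] [LinearOrder Y] [Finite X] [Finite Y]
    (M : X → Y → Prop) {n : ℕ∞} (hX : ENat.card X ≤ n) (hY : ENat.card Y ≤ n) :
    stwwFinite M ≤ n := by
  have h : ∀ D E : Division X Y, D.cols ≤ E.cols → D.rows ≤ E.rows → BigStep M n D E :=
    fun D E hc hr => ⟨hc, hr, fun _ => (classCount_le_card _ _).trans hY,
      fun _ => (classCount_le_card _ _).trans hX⟩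
  exact Contractible.stwwFinite_le ⟨h _ _ le_rfl le_rfl, .single (h _ _ bot_le bot_le)⟩

lemma utwwAction_le_card (Γ X : Type*) [Group Γ] [MulAction Γ X] :
    utwwAction Γ X ≤ ENat.card X := by
  obtain ⟨o, -⟩ := exists_linearOrder_utwwWithOrder_eq Γ X
  exact utwwAction_le fun g A B => stwwFinite_le_card _
    (ENat.card_le_card_of_injective Subtype.val_injective)
    (ENat.card_le_card_of_injective Subtype.val_injective)

theorem utww_le_max_index {G : Type*} [Group G] (H : Subgroup G) [H.FiniteIndex] :
    utww G ≤ max (utww H) H.index := by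
  refine (utww_le_max_cosets H).trans (max_le_max le_rfl ((utwwAction_le_card _ _).trans ?_))
  have h : RightCosets H ≃ G ⧸ H := QuotientGroup.quotientRightRelEquivQuotientLeftRel H
  rw [ENat.card_congr h, Subgroup.index_eq_card, ← ENat.card_eq_coe_natCard]

end Finite

end TwinWidth

namespace TwinWidth

open Relation

/-! ### Grids in matrices of bounded strict twin-width -/

section Grid

/-- A `p × p` grid: intervals of columns and of rows, labelled by natural numbers, such that
the `p × p` zones labelled by numbers less than `p` all contain a `1`. -/
def HasGrid {X Y : Type*} [LinearOrder X] [LinearOrder Y] (M : X → Y → Prop) (p : ℕ) : Prop :=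
  ∃ (f : X → ℕ) (g : Y → ℕ), Monotone f ∧ Monotone g ∧
    ∀ i < p, ∀ j < p, ∃ x y, f x = i ∧ g y = j ∧ M x y

lemma le_classCount {Y : Type*} {r : Setoid Y} {S : Set Y} {n : ℕ} (φ : Fin n → Y)
    (hφ : ∀ i, φ i ∈ S) (h : ∀ i j, i < j → ¬ r (φ i) (φ j)) : (n : ℕ∞) ≤ classCount r S := by
  have hinj : Function.Injective fun i => Quotient.mk r (φ i) := by
    intro i j hij
    by_contra hne
    rcases lt_or_gt_of_ne hne with hlt | hlt
    · exact h _ _ hlt (Quotient.exact hij)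
    · exact h _ _ hlt (Quotient.exact hij.symm)
  have h1 : (Set.range fun i => Quotient.mk r (φ i)).encard = n := by
    rw [← Set.image_univ, hinj.encard_image]; simp
  rw [← h1]
  refine Set.encard_le_encard ?_
  rintro _ ⟨i, rfl⟩
  exact ⟨_, hφ i, rfl⟩

/-- No part of `r` meets labels on both sides of a label less than `p`. -/
def NoSkip {X : Type*} (f : X → ℕ) (p : ℕ) (r : Setoid X) : Prop :=
  ∀ x x', r x x' → ∀ i < p, ¬ (f x < i ∧ i < f x')

/-- A part of `s` with labels on both sides of `i` contains the whole label `i`, hence sees ones at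
the row labels `0, 2, …, 2k`. No part of `r` joins two of these across the odd label between them,
so at least `k + 1` parts are seen. -/
lemma noSkip_of_classCount_le {X Y : Type*} [LinearOrder X] {M : X → Y → Prop} {f : X → ℕ} {g : Y → ℕ} {p k : ℕ}
    (hf : Monotone f) (hM : ∀ i < p, ∀ j < p, ∃ x y, f x = i ∧ g y = j ∧ M x y)
    (hp : 2 * k + 1 ≤ p) {r : Setoid Y} (hr : NoSkip g p r) {s : Setoid X}
    (hs : ∀ x, {x' | s x x'}.OrdConnected)
    (hk : ∀ x, classCount r (colSupport M s x) ≤ k) : NoSkip f p s := by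
  rintro x x' hxx' i hi ⟨h1, h2⟩
  have hex : ∀ j : Fin (k + 1), ∃ x y, f x = i ∧ g y = 2 * j ∧ M x y := fun j =>
    hM i hi _ (by omega)
  choose u v hu hv huv using hex
  have h3 : ((k + 1 : ℕ) : ℕ∞) ≤ classCount r (colSupport M s x) := by
    refine le_classCount v (fun j => ⟨u j, ?_, huv j⟩) ?_
    · refine rel_of_ordConnected hs hxx' ?_ ?_
      · exact (hf.reflect_lt ((hu j).symm ▸ h1)).le
      · exact (hf.reflect_lt ((hu j).symm ▸ h2)).le
    · intro j j' hjj' hrel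
      have := Fin.lt_def.1 hjj'
      exact hr _ _ hrel (2 * j + 1) (by omega) ⟨by rw [hv]; omega, by rw [hv]; omega⟩
  have h4 := h3.trans (hk x)
  rw [Nat.cast_le] at h4
  omega

variable {X Y : Type*} [LinearOrder X] [LinearOrder Y]

/-- No part skips a label at the start, and each coarse step preserves this on both sides. The
trivial division joins labels `0` and `2`, which exist because `k ≥ 1`. -/
theorem Contractible.not_hasGrid {M : X → Y → Prop} {k : ℕ} (hk : 1 ≤ k)
    (h : Contractible M k) : ¬ HasGrid M (2 * k + 1) := by
  rintro ⟨f, g, hf, hg, hM⟩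
  have hM' : ∀ j < 2 * k + 1, ∀ i < 2 * k + 1, ∃ y x, g y = j ∧ f x = i ∧ M x y := by
    intro j hj i hi
    obtain ⟨x, y, h1, h2, h3⟩ := hM i hi j hj
    exact ⟨y, x, h2, h1, h3⟩
  have hinv : ∀ D, ReflTransGen (BigStep M k) Division.finest D →
      NoSkip f (2 * k + 1) D.cols ∧ NoSkip g (2 * k + 1) D.rows := by
    intro D hD
    induction hD with
    | refl =>
      refine ⟨?_, ?_⟩
      · rintro x _ rfl i _ ⟨h1, h2⟩; omega
      · rintro x _ rfl i _ ⟨h1, h2⟩; omega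
    | tail _ hs ih =>
      exact ⟨noSkip_of_classCount_le hf hM le_rfl ih.2 (Division.cols_interval _) hs.col_count,
        noSkip_of_classCount_le (M := fun y x => M x y) hg hM' le_rfl ih.1
          (Division.rows_interval _) hs.row_count⟩
  obtain ⟨x, -, hx, -, -⟩ := hM 0 (by omega) 0 (by omega)
  obtain ⟨x', -, hx', -, -⟩ := hM 2 (by omega) 0 (by omega)
  exact (hinv _ h.2).1 x x' trivial 1 (by omega) (by omega)

lemma exists_card_filter_lt_eq (T : Finset ℕ) {i : ℕ} (hi : i < T.card) :
    ∃ c ∈ T, (T.filter (· < c)).card = i := by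
  have hlt : ∀ c ∈ T, ∀ c' ∈ T, c < c' → (T.filter (· < c)).card < (T.filter (· < c')).card := by
    intro c hc c' hc' h
    refine Finset.card_lt_card (Finset.ssubset_iff_subset_ne.2 ⟨?_, fun heq => ?_⟩)
    · intro z hz
      simp only [Finset.mem_filter] at hz ⊢
      exact ⟨hz.1, hz.2.trans h⟩
    · have : c ∈ T.filter (· < c) := heq ▸ Finset.mem_filter.2 ⟨hc, h⟩
      simp at this
  have hsurj : Set.SurjOn (fun c => (T.filter (· < c)).card) T (Finset.range T.card) := by
    refine Finset.surjOn_of_injOn_of_card_le _ ?_ ?_ (by simp)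
    · intro c hc
      simp only [Finset.coe_range, Set.mem_Iio]
      refine Finset.card_lt_card (Finset.filter_ssubset.2 ⟨c, hc, lt_irrefl c⟩)
    · intro c hc c' hc' h
      by_contra hne
      rcases lt_or_gt_of_ne hne with hl | hl
      · exact absurd h (hlt c hc c' hc' hl).ne
      · exact absurd h.symm (hlt c' hc' c hc hl).ne
  obtain ⟨c, hc, h⟩ := hsurj (Finset.mem_coe.2 (Finset.mem_range.2 hi))
  exact ⟨c, hc, h⟩

/-- Replacing a label by its rank in `T` or `U` is monotone and makes the selected labels
consecutive from `0`. -/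
lemma hasGrid_of_labels {M : X → Y → Prop} {p : ℕ} {f : X → ℕ} {g : Y → ℕ} (hf : Monotone f)
    (hg : Monotone g) (T U : Finset ℕ) (hT : p ≤ T.card) (hU : p ≤ U.card)
    (h : ∀ c ∈ T, ∀ d ∈ U, ∃ x y, f x = c ∧ g y = d ∧ M x y) : HasGrid M p := by
  have hmono : ∀ V : Finset ℕ, Monotone fun c => (V.filter (· < c)).card := by
    intro V a b hab
    exact Finset.card_le_card (Finset.monotone_filter_right V fun z _ hz => lt_of_lt_of_le hz hab)
  refine ⟨fun x => (T.filter (· < f x)).card, fun y => (U.filter (· < g y)).card,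
    (hmono T).comp hf, (hmono U).comp hg, fun i hi j hj => ?_⟩
  obtain ⟨c, hc, hci⟩ := exists_card_filter_lt_eq T (hi.trans_le hT)
  obtain ⟨d, hd, hdj⟩ := exists_card_filter_lt_eq U (hj.trans_le hU)
  obtain ⟨x, y, rfl, rfl, hxy⟩ := h c hc d hd
  exact ⟨x, y, hci, hdj, hxy⟩

end Grid

/-! ### The number of ones of a matrix without grid -/

section MarcusTardos

/-- The block of size `s` of an entry. -/
def blockOf (s : ℕ) (z : ℕ × ℕ) : ℕ × ℕ := (z.1 / s, z.2 / s)

/-- The nonzero columns of a block. -/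
def blockCols (S : Finset (ℕ × ℕ)) (s : ℕ) (B : ℕ × ℕ) : Finset ℕ :=
  (S.filter fun z => blockOf s z = B).image Prod.fst

/-- The blocks with at least `p` nonzero columns. -/
def wideBlocks (S : Finset (ℕ × ℕ)) (s p : ℕ) : Finset (ℕ × ℕ) :=
  (S.image (blockOf s)).filter fun B => p ≤ (blockCols S s B).card

lemma mem_blockCols {S : Finset (ℕ × ℕ)} {s : ℕ} {B : ℕ × ℕ} {x : ℕ} :
    x ∈ blockCols S s B ↔ ∃ y, (x, y) ∈ S ∧ x / s = B.1 ∧ y / s = B.2 := by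
  simp [blockCols, blockOf, Prod.ext_iff]

/-- Pigeonhole on the set of nonzero columns modulo `s`: among more than `p * 2 ^ s` wide blocks,
more than `p` share the same set of at least `p` columns, and these form a grid. -/
lemma card_wideBlocks_column_le {S : Finset (ℕ × ℕ)} {s p : ℕ} (hs : 0 < s)
    (hS : ¬ HasGrid (fun x y => (x, y) ∈ S) p) (a : ℕ) :
    ((wideBlocks S s p).filter fun B => B.1 = a).card ≤ p * 2 ^ s := by
  by_contra! hlt
  let φ : ℕ × ℕ → Finset ℕ := fun B => (blockCols S s B).image (· % s)
  obtain ⟨O, -, hO⟩ := Finset.exists_lt_card_fiber_of_mul_lt_card_of_maps_to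
    (s := (wideBlocks S s p).filter fun B => B.1 = a) (t := (Finset.range s).powerset) (f := φ)
    (n := p) (fun B _ => Finset.mem_powerset.2 fun z hz => by
      obtain ⟨x, -, rfl⟩ := Finset.mem_image.1 hz
      exact Finset.mem_range.2 (Nat.mod_lt _ hs)) (by
      rw [Finset.card_powerset, Finset.card_range, mul_comm]; exact hlt)
  set F := ((wideBlocks S s p).filter fun B => B.1 = a).filter fun B => φ B = O
  have hF : ∀ B ∈ F, B ∈ wideBlocks S s p ∧ B.1 = a ∧ φ B = O := by
    intro B hB
    simpa [F, and_assoc] using hB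
  obtain ⟨B₀, hB₀⟩ := Finset.card_pos.1 (Nat.zero_lt_of_lt hO)
  obtain ⟨hw₀, ha₀, hφ₀⟩ := hF B₀ hB₀
  refine hS (hasGrid_of_labels (f := id) (g := (· / s)) monotone_id
    (fun _ _ h => Nat.div_le_div_right h) (blockCols S s B₀) (F.image Prod.snd)
    (Finset.mem_filter.1 hw₀).2 ?_ ?_)
  · rw [Finset.card_image_of_injOn]
    · exact hO.le
    · intro B hB B' hB' h
      exact Prod.ext ((hF B hB).2.1.trans (hF B' hB').2.1.symm) h
  · intro c hc d hd
    obtain ⟨B, hB, rfl⟩ := Finset.mem_image.1 hd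
    obtain ⟨-, ha, hφ⟩ := hF B hB
    have h1 : c % s ∈ φ B := by
      rw [hφ, ← hφ₀]; exact Finset.mem_image_of_mem _ hc
    obtain ⟨x, hx, hxc⟩ := Finset.mem_image.1 h1
    obtain ⟨y, hxy, hxa, hyd⟩ := mem_blockCols.1 hx
    obtain ⟨_, -, hca, -⟩ := mem_blockCols.1 hc
    have h2 : x = c := by
      rw [← Nat.div_add_mod x s, ← Nat.div_add_mod c s, hxa, hca, ha, ha₀]
      rw [hxc]
    exact ⟨x, y, h2, hyd, hxy⟩

lemma card_wideBlocks_le {S : Finset (ℕ × ℕ)} {s p n : ℕ} (hs : 0 < s)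
    (hS : ¬ HasGrid (fun x y => (x, y) ∈ S) p) (hn : ∀ z ∈ S, z.1 < s * n) :
    (wideBlocks S s p).card ≤ p * 2 ^ s * n := by
  have h := Finset.card_le_mul_card_image_of_maps_to (s := wideBlocks S s p)
    (t := Finset.range n) (f := Prod.fst) (fun B hB => by
      obtain ⟨z, hz, rfl⟩ := Finset.mem_image.1 (Finset.mem_filter.1 hB).1
      exact Finset.mem_range.2 (Nat.div_lt_of_lt_mul (hn z hz))) (p * 2 ^ s)
    (fun a _ => card_wideBlocks_column_le hs hS a)
  rwa [Finset.card_range] at h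

lemma HasGrid.swap {S : Finset (ℕ × ℕ)} {p : ℕ}
    (h : HasGrid (fun x y => (x, y) ∈ S.image Prod.swap) p) :
    HasGrid (fun x y => (x, y) ∈ S) p := by
  obtain ⟨f, g, hf, hg, h⟩ := h
  refine ⟨g, f, hg, hf, fun i hi j hj => ?_⟩
  obtain ⟨x, y, h1, h2, h3⟩ := h j hj i hi
  exact ⟨y, x, h2, h1, by simpa using h3⟩

lemma HasGrid.of_blocks {S : Finset (ℕ × ℕ)} {s p : ℕ}
    (h : HasGrid (fun x y => (x, y) ∈ S.image (blockOf s)) p) :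
    HasGrid (fun x y => (x, y) ∈ S) p := by
  obtain ⟨f, g, hf, hg, h⟩ := h
  have hdiv : Monotone fun x : ℕ => x / s := fun _ _ h => Nat.div_le_div_right h
  refine ⟨fun x => f (x / s), fun y => g (y / s), hf.comp hdiv, hg.comp hdiv, fun i hi j hj => ?_⟩
  obtain ⟨x, y, h1, h2, h3⟩ := h i hi j hj
  obtain ⟨⟨x', y'⟩, hz, hzz⟩ := Finset.mem_image.1 h3
  obtain ⟨rfl, rfl⟩ := Prod.ext_iff.1 hzz
  exact ⟨x', y', h1, h2, hz⟩

/-- A block lies in the product of its nonzero columns and nonzero rows. If neither is numerous,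
both have size at most `q`; rows are columns of the transpose. -/
lemma card_block_le {S : Finset (ℕ × ℕ)} {s q : ℕ} (hs : 0 < s) {B : ℕ × ℕ}
    (hB : B ∈ S.image (blockOf s)) :
    (S.filter fun z => blockOf s z = B).card ≤
      (if B ∈ wideBlocks S s (q + 1) then s * s else 0) +
      (if B.swap ∈ wideBlocks (S.image Prod.swap) s (q + 1) then s * s else 0) + q * q := by
  have hcols : ∀ (S : Finset (ℕ × ℕ)) B, (blockCols S s B).card ≤ s := by
    intro S B
    have h : blockCols S s B ⊆ Finset.Ico (s * B.1) (s * B.1 + s) := by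
      intro x hx
      obtain ⟨y, -, h1, -⟩ := mem_blockCols.1 hx
      rw [Finset.mem_Ico, ← h1]
      exact ⟨Nat.mul_div_le x s, Nat.lt_mul_div_succ x hs⟩
    simpa using Finset.card_le_card h
  have hprod : (S.filter fun z => blockOf s z = B).card ≤
      (blockCols S s B).card * (blockCols (S.image Prod.swap) s B.swap).card := by
    rw [← Finset.card_product]
    refine Finset.card_le_card fun z hz => ?_
    obtain ⟨h1, h2⟩ := Finset.mem_filter.1 hz
    obtain ⟨h3, h4⟩ := Prod.ext_iff.1 h2
    exact Finset.mem_product.2 ⟨mem_blockCols.2 ⟨z.2, h1, h3, h4⟩,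
      mem_blockCols.2 ⟨z.1, Finset.mem_image.2 ⟨z, h1, rfl⟩, h4, h3⟩⟩
  refine hprod.trans ?_
  have hss := Nat.mul_le_mul (hcols S B) (hcols (S.image Prod.swap) B.swap)
  split_ifs with h1 h2 h2
  · omega
  · omega
  · omega
  · have hB' : B.swap ∈ (S.image Prod.swap).image (blockOf s) := by
      obtain ⟨z, hz, rfl⟩ := Finset.mem_image.1 hB
      exact Finset.mem_image.2 ⟨z.swap, Finset.mem_image_of_mem _ hz, rfl⟩
    have h3 : (blockCols S s B).card ≤ q := by
      by_contra! h; exact h1 (Finset.mem_filter.2 ⟨hB, h⟩)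
    have h4 : (blockCols (S.image Prod.swap) s B.swap).card ≤ q := by
      by_contra! h; exact h2 (Finset.mem_filter.2 ⟨hB', h⟩)
    have := Nat.mul_le_mul h3 h4
    omega

/-- Marcus–Tardos recursion with blocks of side `(q + 1) ^ 2`: wide blocks are few, and the others
hold at most `q * q` ones each, their number being bounded by induction on the compressed matrix. -/
lemma card_le_of_not_hasGrid_pow {q : ℕ} (j : ℕ) (S : Finset (ℕ × ℕ))
    (hS : ¬ HasGrid (fun x y => (x, y) ∈ S) (q + 1))
    (hn : ∀ z ∈ S, z.1 < ((q + 1) ^ 2) ^ j ∧ z.2 < ((q + 1) ^ 2) ^ j) :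
    S.card ≤ 2 * (q + 1) ^ 5 * 2 ^ (q + 1) ^ 2 * ((q + 1) ^ 2) ^ j := by
  induction j generalizing S with
  | zero =>
    have h : S ⊆ {(0, 0)} := fun z hz => by
      have := hn z hz
      simp only [pow_zero, Nat.lt_one_iff] at this
      exact Finset.mem_singleton.2 (Prod.ext this.1 this.2)
    refine (Finset.card_le_card h).trans ?_
    rw [Finset.card_singleton]
    exact Nat.one_le_iff_ne_zero.2 (by positivity)
  | succ j ih =>
    set s := (q + 1) ^ 2 with hsdef
    have hs : 0 < s := by positivity
    have hn' : ∀ z ∈ S, z.1 < s * s ^ j ∧ z.2 < s * s ^ j := fun z hz => by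
      have := hn z hz
      rwa [pow_succ'] at this
    have h1 := ih (S.image (blockOf s)) (fun h => hS h.of_blocks) (by
      intro B hB
      obtain ⟨z, hz, rfl⟩ := Finset.mem_image.1 hB
      exact ⟨Nat.div_lt_of_lt_mul (hn' z hz).1, Nat.div_lt_of_lt_mul (hn' z hz).2⟩)
    have h2 := card_wideBlocks_le hs hS (fun z hz => (hn' z hz).1)
    have h3 := card_wideBlocks_le (S := S.image Prod.swap) (n := s ^ j) hs (fun h => hS h.swap)
      (fun z hz => by
        obtain ⟨w, hw, rfl⟩ := Finset.mem_image.1 hz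
        exact (hn' w hw).2)
    have hsum : S.card ≤ s * s * (wideBlocks S s (q + 1)).card +
        s * s * (wideBlocks (S.image Prod.swap) s (q + 1)).card +
        q * q * (S.image (blockOf s)).card := by
      rw [Finset.card_eq_sum_card_image (blockOf s) S]
      refine (Finset.sum_le_sum fun B hB => card_block_le (q := q) hs hB).trans ?_
      rw [Finset.sum_add_distrib, Finset.sum_add_distrib]
      refine Nat.add_le_add (Nat.add_le_add ?_ ?_) ?_
      · rw [← Finset.sum_filter, Finset.sum_const, smul_eq_mul, mul_comm]
        refine Nat.mul_le_mul_left _ (Finset.card_le_card fun B hB => ?_)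
        exact (Finset.mem_filter.1 hB).2
      · rw [← Finset.sum_filter, Finset.sum_const, smul_eq_mul, mul_comm]
        refine Nat.mul_le_mul_left _ (Finset.card_le_card_of_injOn Prod.swap (fun B hB => ?_)
          Prod.swap_injective.injOn)
        exact (Finset.mem_filter.1 hB).2
      · rw [Finset.sum_const, smul_eq_mul, mul_comm]
    have h4 := Nat.mul_le_mul_left (s * s) h2
    have h5 := Nat.mul_le_mul_left (s * s) h3
    have h6 := Nat.mul_le_mul_left (q * q) h1
    refine hsum.trans ((Nat.add_le_add (Nat.add_le_add h4 h5) h6).trans ?_)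
    rw [pow_succ s j]
    -- The constant is chosen so that the two wide terms add up to exactly one copy of the inductive
    -- bound; the recursion closes since `q * q + 1 ≤ (q + 1) ^ 2`.
    have h7 : s * s * ((q + 1) * 2 ^ s * s ^ j) + s * s * ((q + 1) * 2 ^ s * s ^ j) +
        q * q * (2 * (q + 1) ^ 5 * 2 ^ s * s ^ j) =
        (2 * (q + 1) ^ 5 * 2 ^ s * s ^ j) * (q * q + 1) := by
      generalize 2 ^ s = t
      generalize s ^ j = u
      rw [hsdef]; ring
    rw [h7, ← mul_assoc]
    refine Nat.mul_le_mul_left _ ?_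
    rw [hsdef]; nlinarith

/-- The constant in the bound on the number of ones of a matrix without `p × p` grid. -/
def gridConst (p : ℕ) : ℕ := 2 * p ^ 5 * 2 ^ p ^ 2 * p ^ 2

theorem card_le_of_not_hasGrid {p n : ℕ} (hp : 2 ≤ p) (S : Finset (ℕ × ℕ))
    (hS : ¬ HasGrid (fun x y => (x, y) ∈ S) p) (hn : ∀ z ∈ S, z.1 < n ∧ z.2 < n) :
    S.card ≤ gridConst p * n := by
  obtain ⟨q, rfl⟩ : ∃ q, p = q + 1 := ⟨p - 1, by omega⟩
  rcases Nat.eq_zero_or_pos n with rfl | hn0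
  · have : S = ∅ := Finset.eq_empty_of_forall_notMem fun z hz => by have := hn z hz; omega
    simp [this]
  have hs : 1 < (q + 1) ^ 2 := by nlinarith
  have hj : n ≤ ((q + 1) ^ 2) ^ Nat.clog ((q + 1) ^ 2) n := Nat.le_pow_clog hs n
  -- Rounding `n` up to a power of `p ^ 2` costs the last factor of `gridConst`.
  have hj' : ((q + 1) ^ 2) ^ Nat.clog ((q + 1) ^ 2) n ≤ (q + 1) ^ 2 * n := by
    rcases Nat.eq_or_lt_of_le (Nat.succ_le_of_lt hn0) with h | h
    · rw [← h]; simp; nlinarith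
    · have h1 := Nat.pow_pred_clog_lt_self hs h
      have h2 : Nat.clog ((q + 1) ^ 2) n = (Nat.clog ((q + 1) ^ 2) n).pred + 1 :=
        (Nat.succ_pred_eq_of_pos (Nat.clog_pos hs h)).symm
      rw [h2, pow_succ, mul_comm]
      exact Nat.mul_le_mul_left _ h1.le
  have h := card_le_of_not_hasGrid_pow _ S hS fun z hz =>
    ⟨(hn z hz).1.trans_le hj, (hn z hz).2.trans_le hj⟩
  refine h.trans ((Nat.mul_le_mul_left _ hj').trans ?_)
  rw [gridConst, ← mul_assoc]

end MarcusTardos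

end TwinWidth

namespace TwinWidth

open Relation

/-! ### Greedy merging -/

section Greedy

variable {X Y : Type*} [LinearOrder X] [LinearOrder Y]

/-- The division whose parts are the fibers of monotone maps. -/
def kerDivision {f : X → ℕ} {g : Y → ℕ} (hf : Monotone f) (hg : Monotone g) : Division X Y where
  cols := Setoid.ker f
  rows := Setoid.ker g
  cols_interval := ordConnected_of_rel fun x _ z h h1 h2 =>
    le_antisymm (hf h1) ((hf h2).trans_eq (show f z = f x from Eq.symm h))
  rows_interval := ordConnected_of_rel fun x _ z h h1 h2 =>
    le_antisymm (hg h1) ((hg h2).trans_eq (show g z = g x from Eq.symm h))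

/-- The transposed division. -/
def Division.swap (D : Division X Y) : Division Y X :=
  ⟨D.rows, D.cols, D.rows_interval, D.cols_interval⟩

lemma BigStep.swap {M : X → Y → Prop} {k : ℕ∞} {D E : Division X Y} (h : BigStep M k D E) :
    BigStep (fun y x => M x y) k D.swap E.swap :=
  ⟨h.rows_le, h.cols_le, h.row_count, h.col_count⟩

lemma HasGrid.transpose {M : X → Y → Prop} {p : ℕ} (h : HasGrid M p) :
    HasGrid (fun y x => M x y) p := by
  obtain ⟨f, g, hf, hg, h⟩ := h
  refine ⟨g, f, hg, hf, fun i hi j hj => ?_⟩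
  obtain ⟨x, y, h1, h2, h3⟩ := h j hj i hi
  exact ⟨y, x, h2, h1, h3⟩

/-- The quotient has at most `gridConst p * m` ones. In the sum over the `m - 1` consecutive pairs
of column labels each column is counted at most twice, so by `m ≤ 2 * (m - 1)` some pair has at most
`4 * gridConst p` ones in total. -/
lemma exists_merge_cols {M : X → Y → Prop} {p m n : ℕ} (hp : 2 ≤ p) (hM : ¬ HasGrid M p)
    {f : X → ℕ} {g : Y → ℕ} (hf : Monotone f) (hg : Monotone g) (hfm : ∀ x, f x < m)
    (hgn : ∀ y, g y < n) (hm : 2 ≤ m) (hnm : n ≤ m)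
    (hD : BigStep M (4 * gridConst p : ℕ) (kerDivision hf hg) (kerDivision hf hg)) :
    ∃ (f' : X → ℕ) (hf' : Monotone f'), (∀ x, f' x < m - 1) ∧
      BigStep M (4 * gridConst p : ℕ) (kerDivision hf hg) (kerDivision hf' hg) := by
  classical
  let S : Finset (ℕ × ℕ) := (Finset.range m ×ˢ Finset.range n).filter
    fun z => ∃ x y, f x = z.1 ∧ g y = z.2 ∧ M x y
  have hmem : ∀ x y, M x y → (f x, g y) ∈ S := fun x y h =>
    Finset.mem_filter.2 ⟨by simp [hfm, hgn], x, y, rfl, rfl, h⟩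
  have hS : ¬ HasGrid (fun x y => (x, y) ∈ S) p := by
    rintro ⟨u, v, hu, hv, h⟩
    refine hM ⟨u ∘ f, v ∘ g, hu.comp hf, hv.comp hg, fun i hi j hj => ?_⟩
    obtain ⟨a, b, ha, hb, hab⟩ := h i hi j hj
    obtain ⟨x, y, rfl, rfl, hxy⟩ := (Finset.mem_filter.1 hab).2
    exact ⟨x, y, ha, hb, hxy⟩
  have hcard : S.card ≤ gridConst p * m := by
    refine card_le_of_not_hasGrid hp S hS fun z hz => ?_
    have := Finset.mem_product.1 (Finset.mem_filter.1 hz).1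
    simp only [Finset.mem_range] at this
    exact ⟨this.1, this.2.trans_le hnm⟩
  let c : ℕ → ℕ := fun i => (S.filter fun z => z.1 = i).card
  have hsum : ∑ i ∈ Finset.range m, c i = S.card :=
    (Finset.card_eq_sum_card_fiberwise fun z hz =>
      (Finset.mem_product.1 (Finset.mem_filter.1 hz).1).1).symm
  obtain ⟨l, rfl⟩ : ∃ l, m = l + 1 := ⟨m - 1, by omega⟩
  obtain ⟨i, hi, hci⟩ : ∃ i ∈ Finset.range l, c i + c (i + 1) ≤ 4 * gridConst p := by
    refine Finset.exists_le_of_sum_le ⟨0, Finset.mem_range.2 (by omega)⟩ ?_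
    rw [Finset.sum_add_distrib, Finset.sum_const, Finset.card_range, smul_eq_mul]
    have h1 := Finset.sum_range_succ c l
    have h2 := Finset.sum_range_succ' c l
    rw [hsum] at h1 h2
    have h3 : gridConst p * (l + 1) ≤ gridConst p * (2 * l) := Nat.mul_le_mul_left _ (by omega)
    have h4 : l * (4 * gridConst p) = 2 * (gridConst p * (2 * l)) := by ring
    omega
  -- Labels above `i` move down by one, which merges `i` and `i + 1`.
  let f' : X → ℕ := fun x => if f x ≤ i then f x else f x - 1
  have hf' : Monotone f' := by
    intro x y hxy
    have := hf hxy
    simp only [f']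
    split_ifs <;> omega
  have hker : ∀ x x', f' x = f' x' → f x = f x' ∨ ((f x = i ∨ f x = i + 1) ∧
      (f x' = i ∨ f x' = i + 1)) := by
    intro x x' h
    simp only [f'] at h
    split_ifs at h <;> omega
  have hil := Finset.mem_range.1 hi
  have hle : (kerDivision hf hg).cols ≤ (kerDivision hf' hg).cols := fun x x' h => by
    have h' : f x = f x' := h
    change f' x = f' x'
    simp only [f', h']
  refine ⟨f', hf', fun x => ?_, hle, le_rfl, fun x => ?_, hD.row_count⟩
  · have := hfm x
    simp only [f']
    split_ifs <;> omega
  · by_cases hx : f x = i ∨ f x = i + 1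
    · refine (classCount_ker_le g _).trans ?_
      let T : Finset ℕ := (S.filter fun z => z.1 = i).image Prod.snd ∪
        (S.filter fun z => z.1 = i + 1).image Prod.snd
      have hT : T.card ≤ 4 * gridConst p :=
        (Finset.card_union_le _ _).trans ((Nat.add_le_add Finset.card_image_le
          Finset.card_image_le).trans hci)
      refine (Set.encard_le_encard (t := (T : Set ℕ)) ?_).trans ?_
      · rintro _ ⟨y, ⟨x', hx', hxy⟩, rfl⟩
        have h1 : f x' = i ∨ f x' = i + 1 := by
          rcases hker x x' hx' with h | h
          · rwa [← h]
          · exact h.2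
        have h2 := hmem x' y hxy
        rw [Finset.mem_coe, Finset.mem_union, Finset.mem_image, Finset.mem_image]
        rcases h1 with h1 | h1
        · exact Or.inl ⟨_, Finset.mem_filter.2 ⟨h2, h1⟩, rfl⟩
        · exact Or.inr ⟨_, Finset.mem_filter.2 ⟨h2, h1⟩, rfl⟩
      · rw [Set.encard_coe_eq_coe_finsetCard]
        exact_mod_cast hT
    · refine le_trans (classCount_mono le_rfl ?_) (hD.col_count x)
      rintro y ⟨x', hx', hxy⟩
      rcases hker x x' hx' with h | h
      · exact ⟨x', h, hxy⟩
      · exact absurd h.1 hx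

/-- Always merge on the side with the larger label bound, as `exists_merge_cols` requires; `m + n`
decreases. -/
lemma path_of_not_hasGrid {M : X → Y → Prop} {p : ℕ} (hp : 2 ≤ p) (hM : ¬ HasGrid M p)
    (N : ℕ) : ∀ {m n : ℕ} {f : X → ℕ} {g : Y → ℕ} (hf : Monotone f) (hg : Monotone g),
    m + n ≤ N → (∀ x, f x < m) → (∀ y, g y < n) →
    BigStep M (4 * gridConst p : ℕ) (kerDivision hf hg) (kerDivision hf hg) →
    ReflTransGen (BigStep M (4 * gridConst p : ℕ)) (kerDivision hf hg) Division.trivial := by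
  induction N with
  | zero =>
    intro m n f g hf hg hN hfm hgn _
    have h : kerDivision hf hg = Division.trivial :=
      Division.ext (Setoid.ext fun x _ => absurd (hfm x) (by omega))
        (Setoid.ext fun y _ => absurd (hgn y) (by omega))
    rw [h]
  | succ N ih =>
    intro m n f g hf hg hN hfm hgn hD
    by_cases hsmall : m ≤ 1 ∧ n ≤ 1
    · have h : kerDivision hf hg = Division.trivial := by
        refine Division.ext (Setoid.ext fun x x' => ⟨fun _ => trivial, fun _ => ?_⟩)
          (Setoid.ext fun y y' => ⟨fun _ => trivial, fun _ => ?_⟩)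
        · have h1 := hfm x
          have h2 := hfm x'
          exact show f x = f x' by omega
        · have h1 := hgn y
          have h2 := hgn y'
          exact show g y = g y' by omega
      rw [h]
    · rcases le_total n m with hnm | hnm
      · obtain ⟨f', hf', hfm', hs⟩ :=
          exists_merge_cols hp hM hf hg hfm hgn (by omega) hnm hD
        exact (ih hf' hg (by omega) hfm' hgn hs.right).head hs
      · obtain ⟨g', hg', hgn', hs⟩ := exists_merge_cols (M := fun y x => M x y) hp
          (fun h => hM h.transpose) hg hf hgn hfm (by omega) hnm hD.swap
        have hs' : BigStep M (4 * gridConst p : ℕ) (kerDivision hf hg) (kerDivision hf hg') :=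
          hs.swap
        exact (ih hf hg' (by omega) hfm hgn' hs'.right).head hs'

theorem Contractible.of_not_hasGrid [Finite X] [Finite Y] {M : X → Y → Prop} {p : ℕ} (hp : 2 ≤ p)
    (hfun : ∀ x y y', M x y → M x y' → y = y') (hinj : ∀ x x' y, M x y → M x' y → x = x')
    (hM : ¬ HasGrid M p) : Contractible M (4 * gridConst p : ℕ) := by
  cases nonempty_fintype X
  cases nonempty_fintype Y
  let eX := Fintype.orderIsoFinOfCardEq X rfl
  let eY := Fintype.orderIsoFinOfCardEq Y rfl
  have hf : StrictMono fun x => (eX.symm x : ℕ) := fun _ _ h => eX.symm.strictMono h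
  have hg : StrictMono fun y => (eY.symm y : ℕ) := fun _ _ h => eY.symm.strictMono h
  have h0 : kerDivision hf.monotone hg.monotone = Division.finest :=
    Division.ext (Setoid.ext fun _ _ => hf.injective.eq_iff)
      (Setoid.ext fun _ _ => hg.injective.eq_iff)
  have hone : (1 : ℕ∞) ≤ (4 * gridConst p : ℕ) := by
    have : 0 < gridConst p := by unfold gridConst; positivity
    exact_mod_cast (by omega : 1 ≤ 4 * gridConst p)
  have hfin : BigStep M (4 * gridConst p : ℕ) Division.finest Division.finest := by
    refine ⟨le_rfl, le_rfl, fun x => ?_, fun y => ?_⟩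
    · refine ((Set.encard_image_le _ _).trans (Set.encard_le_one_iff.2 ?_)).trans hone
      rintro y y' ⟨x', rfl, h⟩ ⟨x'', rfl, h'⟩
      exact hfun _ _ _ h h'
    · refine ((Set.encard_image_le _ _).trans (Set.encard_le_one_iff.2 ?_)).trans hone
      rintro x x' ⟨y', rfl, h⟩ ⟨y'', rfl, h'⟩
      exact hinj _ _ _ h h'
  refine ⟨hfin, ?_⟩
  rw [← h0] at hfin ⊢
  exact path_of_not_hasGrid hp hM _ hf.monotone hg.monotone le_rfl (fun x => (eX.symm x).2)
    (fun y => (eY.symm y).2) hfin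

end Greedy

/-! ### Unions of matrices and finite normal subgroups -/

section Union

/-- The bipartite Ramsey theorem. -/
lemma exists_monochromatic_rectangle {C : Type*} [Fintype C] [Nonempty C] [DecidableEq C] (K : ℕ)
    (χ : ℕ → ℕ → C) :
    ∃ (c : C) (T U : Finset ℕ), T ⊆ Finset.range (Fintype.card C * K) ∧
      U ⊆ Finset.range (Fintype.card C * 2 ^ (Fintype.card C * K) * K) ∧
      K ≤ T.card ∧ K ≤ U.card ∧ ∀ i ∈ T, ∀ j ∈ U, χ i j = c := by
  set t := Fintype.card C
  have h1 : ∀ j, ∃ c, K ≤ ((Finset.range (t * K)).filter fun i => χ i j = c).card := by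
    intro j
    obtain ⟨c, -, hc⟩ := Finset.exists_le_card_fiber_of_mul_le_card_of_maps_to
      (s := Finset.range (t * K)) (t := (Finset.univ : Finset C)) (f := fun i => χ i j) (n := K)
      (fun _ _ => Finset.mem_univ _) Finset.univ_nonempty (by simp [t])
    exact ⟨c, hc⟩
  choose c hc using h1
  -- Each `j` has a majority color and a set of rows where it occurs. There are `t * 2 ^ (t * K)`
  -- such pairs, so `K` indices share one.
  let φ : ℕ → C × Finset ℕ := fun j => (c j, (Finset.range (t * K)).filter fun i => χ i j = c j)
  obtain ⟨⟨d, T⟩, -, hU⟩ := Finset.exists_le_card_fiber_of_mul_le_card_of_maps_to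
    (s := Finset.range (t * 2 ^ (t * K) * K))
    (t := (Finset.univ : Finset C) ×ˢ (Finset.range (t * K)).powerset) (f := φ) (n := K)
    (fun j _ => Finset.mem_product.2 ⟨Finset.mem_univ _, Finset.mem_powerset.2
      (Finset.filter_subset _ _)⟩)
    (Finset.univ_nonempty.product ⟨∅, by simp⟩) (by simp [t, Finset.card_product])
  set U := (Finset.range (t * 2 ^ (t * K) * K)).filter fun j => φ j = (d, T)
  have hUT : ∀ j ∈ U, c j = d ∧ ((Finset.range (t * K)).filter fun i => χ i j = c j) = T :=
    fun j hj => Prod.ext_iff.1 (Finset.mem_filter.1 hj).2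
  rcases Nat.eq_zero_or_pos K with rfl | hK
  · exact ⟨d, ∅, ∅, by simp, by simp, by simp, by simp, by simp⟩
  obtain ⟨j₀, hj₀⟩ := Finset.card_pos.1 (hK.trans_le hU)
  obtain ⟨-, hT⟩ := hUT j₀ hj₀
  refine ⟨d, T, U, hT ▸ Finset.filter_subset _ _, Finset.filter_subset _ _, hT ▸ hc j₀, hU, ?_⟩
  intro i hi j hj
  obtain ⟨h2, h3⟩ := hUT j hj
  rw [← h3] at hi
  exact (Finset.mem_filter.1 hi).2.trans h2

variable {X Y : Type*} [LinearOrder X] [LinearOrder Y]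

/-- Color each zone by a matrix contributing a `1` to it; a monochromatic rectangle is a grid of
that matrix. -/
lemma HasGrid.of_union {C : Type*} [Fintype C] [Nonempty C] {M : X → Y → Prop}
    {M' : C → X → Y → Prop} (hM : ∀ x y, M x y → ∃ c, M' c x y) {K : ℕ}
    (h : HasGrid M (Fintype.card C * 2 ^ (Fintype.card C * K) * K)) : ∃ c, HasGrid (M' c) K := by
  classical
  obtain ⟨f, g, hf, hg, h⟩ := h
  set p := Fintype.card C * 2 ^ (Fintype.card C * K) * K with hpdef
  have h1 : ∀ i j, ∃ c, i < p → j < p → ∃ x y, f x = i ∧ g y = j ∧ M' c x y := by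
    intro i j
    by_cases hij : i < p ∧ j < p
    · obtain ⟨x, y, hx, hy, hxy⟩ := h i hij.1 j hij.2
      obtain ⟨c, hc⟩ := hM x y hxy
      exact ⟨c, fun _ _ => ⟨x, y, hx, hy, hc⟩⟩
    · exact ⟨Classical.arbitrary C, fun hi hj => absurd ⟨hi, hj⟩ hij⟩
  choose χ hχ using h1
  obtain ⟨c, T, U, hT, hU, hTK, hUK, hTU⟩ := exists_monochromatic_rectangle K χ
  have hle : Fintype.card C * K ≤ p := by
    rw [hpdef, mul_right_comm]
    exact Nat.le_mul_of_pos_right _ (by positivity)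
  refine ⟨c, hasGrid_of_labels hf hg T U hTK hUK fun i hi j hj => ?_⟩
  rw [← hTU i hi j hj]
  exact hχ i j ((Finset.mem_range.1 (hT hi)).trans_le hle) (Finset.mem_range.1 (hU hj))

/-- With `P` the Ramsey size, `4 * gridConst P ≤ 2 ^ P ^ 5` and `P ≤ t ^ (5 * t * k)`, whence the
constant `25`. -/
lemma four_mul_gridConst_le {t k : ℕ} (ht : 2 ≤ t) (hk : 1 ≤ k) :
    4 * gridConst (t * 2 ^ (t * (2 * k + 1)) * (2 * k + 1)) ≤ 2 ^ t ^ (25 * t * k) := by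
  set P := t * 2 ^ (t * (2 * k + 1)) * (2 * k + 1) with hP
  have h2P : 2 ≤ P := by
    rw [hP]
    calc 2 = 2 * 1 * 1 := rfl
      _ ≤ t * 2 ^ (t * (2 * k + 1)) * (2 * k + 1) :=
        Nat.mul_le_mul (Nat.mul_le_mul ht Nat.one_le_two_pow) (by omega)
  have htk : t ≤ t * k := Nat.le_mul_of_pos_right _ hk
  have htk' : 2 * k ≤ t * k := Nat.mul_le_mul_right _ ht
  have ht0 : 0 < t := by omega
  have hPt : P ≤ t ^ (5 * (t * k)) := by
    have h1 : t ≤ t ^ (t * k) := Nat.le_self_pow (by omega) t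
    have h2 : 2 ^ (t * (2 * k + 1)) ≤ t ^ (3 * (t * k)) :=
      (Nat.pow_le_pow_left ht _).trans (Nat.pow_le_pow_right ht0 (by
        rw [mul_add, mul_one, mul_left_comm]; omega))
    have h3 : 2 * k + 1 ≤ t ^ (t * k) :=
      (Nat.succ_le_of_lt (Nat.lt_two_pow_self (n := 2 * k))).trans
        ((Nat.pow_le_pow_left ht _).trans (Nat.pow_le_pow_right ht0 htk'))
    calc P ≤ t ^ (t * k) * t ^ (3 * (t * k)) * t ^ (t * k) :=
          Nat.mul_le_mul (Nat.mul_le_mul h1 h2) h3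
      _ = t ^ (5 * (t * k)) := by rw [← pow_add, ← pow_add]; congr 1; ring
  have hP5 : P ^ 5 ≤ t ^ (25 * t * k) := by
    calc P ^ 5 ≤ (t ^ (5 * (t * k))) ^ 5 := Nat.pow_le_pow_left hPt 5
      _ = t ^ (25 * t * k) := by rw [← pow_mul]; congr 1; ring
  have hP7 : P ^ 7 ≤ 2 ^ (7 * P) := by
    rw [mul_comm, pow_mul]
    exact Nat.pow_le_pow_left Nat.lt_two_pow_self.le 7
  have hexp : 3 + 7 * P + P ^ 2 ≤ P ^ 5 := by
    obtain ⟨r, hr⟩ := Nat.exists_eq_add_of_le h2P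
    rw [hr]
    ring_nf
    nlinarith [Nat.zero_le (r ^ 2), Nat.zero_le (r ^ 3), Nat.zero_le (r ^ 4), Nat.zero_le (r ^ 5)]
  calc 4 * gridConst P = 2 ^ 3 * P ^ 7 * 2 ^ P ^ 2 := by rw [gridConst]; ring
    _ ≤ 2 ^ 3 * 2 ^ (7 * P) * 2 ^ P ^ 2 :=
        Nat.mul_le_mul_right _ (Nat.mul_le_mul_left _ hP7)
    _ = 2 ^ (3 + 7 * P + P ^ 2) := by rw [pow_add, pow_add]
    _ ≤ 2 ^ t ^ (25 * t * k) := Nat.pow_le_pow_right (by norm_num) (hexp.trans hP5)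

end Union

/-! ### Quotients by finite normal subgroups -/

section FiniteNormal

variable {G : Type*} [Group G] (N : Subgroup G) [N.Normal]

/-- Order the cosets by representatives. If `g` maps `a` to `b`, then `b.out = a.out * g.out * n`
for some `n` in `N`, so the matrix of `g` is covered by `|N|` submatrices of matrices of `G`, none
with a grid of size `2 * k + 1`. -/
theorem utww_quotient_le [Finite N] (ht : 2 ≤ Nat.card N) {k : ℕ} (hk : utww G = k) :
    utww (G ⧸ N) ≤ (2 ^ Nat.card N ^ (25 * Nat.card N * k) : ℕ) := by
  cases nonempty_fintype N
  rw [Nat.card_eq_fintype_card] at ht ⊢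
  have hk1 : 1 ≤ k := by
    have h := one_le_utww G
    rw [hk] at h
    exact_mod_cast h
  obtain ⟨o, ho⟩ := exists_linearOrder_utwwWithOrder_eq Gᵐᵒᵖ G
  have hout : Function.Injective (Quotient.out : G ⧸ N → G) :=
    Function.LeftInverse.injective Quotient.out_eq
  let _ : LinearOrder (G ⧸ N) := LinearOrder.lift' Quotient.out hout
  refine utwwAction_le fun g A B => ?_
  let M : A → B → Prop := fun a b => g • (a : G ⧸ N) = b
  let M' : N → A → B → Prop := fun n a b =>
    MulOpposite.op (Quotient.out g.unop * (n : G)) • Quotient.out (a : G ⧸ N) =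
      Quotient.out (b : G ⧸ N)
  have hMM' : ∀ a b, M a b → ∃ n, M' n a b := by
    intro a b hab
    have h1 : (Quotient.out (a : G ⧸ N) * Quotient.out g.unop)⁻¹ * Quotient.out (b : G ⧸ N) ∈ N := by
      rw [← QuotientGroup.eq, QuotientGroup.mk_mul]
      simp only [QuotientGroup.out_eq']
      exact hab
    refine ⟨⟨_, h1⟩, ?_⟩
    simp [M', mul_assoc]
  have hM' : ∀ n, Contractible (M' n) k := fun n => by
    refine contractible_of_stwwFinite_le ?_
    refine (stwwFinite_le_utwwWithOrder (Γ := Gᵐᵒᵖ) (X := G)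
      (MulOpposite.op (Quotient.out g.unop * (n : G)))
      (f := fun a : A => Quotient.out (a : G ⧸ N)) (f' := fun b : B => Quotient.out (b : G ⧸ N))
      (fun _ _ h => h) (fun _ _ h => h) fun _ _ h => h).trans ?_
    exact (ho.trans hk).le
  have hgrid : ¬ HasGrid M
      (Fintype.card N * 2 ^ (Fintype.card N * (2 * k + 1)) * (2 * k + 1)) := fun h => by
    obtain ⟨n, hn⟩ := HasGrid.of_union hMM' h
    exact (hM' n).not_hasGrid hk1 hn
  have hp : 2 ≤ Fintype.card N * 2 ^ (Fintype.card N * (2 * k + 1)) * (2 * k + 1) :=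
    calc 2 = 2 * 1 * 1 := rfl
      _ ≤ _ := Nat.mul_le_mul (Nat.mul_le_mul ht Nat.one_le_two_pow) (by omega)
  refine (Contractible.of_not_hasGrid (M := M) hp ?_ ?_ hgrid).stwwFinite_le.trans ?_
  · intro a b b' h h'
    exact Subtype.ext (h.symm.trans h')
  · intro a a' b h h'
    exact Subtype.ext (MulAction.injective g (h.trans h'.symm))
  · exact_mod_cast four_mul_gridConst_le ht hk1

theorem utww_le_max_quotient : utww G ≤ max (utww (G ⧸ N)) (ENat.card N) := by
  let S : GroupExtension N G (G ⧸ N) :=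
    { inl := N.subtype
      rightHom := QuotientGroup.mk' N
      inl_injective := N.subtype_injective
      range_inl_eq_ker_rightHom := by simp
      rightHom_surjective := QuotientGroup.mk'_surjective N }
  refine (utww_extension_le S).trans ?_
  rw [max_comm]
  exact max_le_max le_rfl (utwwAction_le_card _ _)

lemma utww_quotient_eq_of_card_eq_one (h : Nat.card N = 1) : utww (G ⧸ N) = utww G := by
  refine (utww_congr (MulEquiv.ofBijective (QuotientGroup.mk' N)
    ⟨?_, QuotientGroup.mk'_surjective N⟩)).symm
  rw [← MonoidHom.ker_eq_bot_iff, QuotientGroup.ker_mk']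
  exact Subgroup.card_eq_one.1 h

end FiniteNormal

end TwinWidth

theorem lemma1p5 :
    -- Coset actions: `utww(G) ≤ max(utww(H), utww(G ↷ G/H))` for every subgroup `H ≤ G`.
    (∀ (G : Type u) [Group G] (H : Subgroup G),
      TwinWidth.utww G ≤
        max (TwinWidth.utww H) (TwinWidth.utwwAction Gᵐᵒᵖ (TwinWidth.RightCosets H))) ∧
    -- (1) Group extensions `1 → N → E → Q → 1`.
    (∀ (N : Type u) (E : Type v) (Q : Type w) [Group N] [Group E] [Group Q],
      GroupExtension N E Q →
        TwinWidth.utww E ≤ max (TwinWidth.utww N) (TwinWidth.utww Q)) ∧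
    -- Semidirect products.
    (∀ (G : Type u) (H : Type v) [Group G] [Group H] (φ : H →* MulAut G),
      TwinWidth.utww (G ⋊[φ] H) = max (TwinWidth.utww G) (TwinWidth.utww H)) ∧
    -- Cartesian products.
    (∀ (G : Type u) (H : Type v) [Group G] [Group H],
      TwinWidth.utww (G × H) = max (TwinWidth.utww G) (TwinWidth.utww H)) ∧
    -- (2) Direct products and direct sums of non-empty, possibly infinite families.
    (∀ (ι : Type v) [Nonempty ι] (G : ι → Type u) [∀ i, Group (G i)],
      TwinWidth.utww (∀ i, G i) = ⨆ i, TwinWidth.utww (G i) ∧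
      TwinWidth.utww (TwinWidth.directSum G) = ⨆ i, TwinWidth.utww (G i)) ∧
    -- (3) Direct limits, i.e. unions of directed families of subgroups.
    (∀ (G : Type u) [Group G] (ι : Type v) (K : ι → Subgroup G),
      Directed (· ≤ ·) K → (∀ g : G, ∃ i, g ∈ K i) →
        TwinWidth.utww G = ⨆ i, TwinWidth.utww (K i)) ∧
    -- (4) Supergroups of finite index.
    (∀ (G : Type u) [Group G] (H : Subgroup G) [H.FiniteIndex],
      TwinWidth.utww H ≤ TwinWidth.utww G ∧
      TwinWidth.utww G ≤ max (TwinWidth.utww H) (H.index : ℕ∞)) ∧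
    -- (5) Quotients by finite normal subgroups; the constant `C` is universal.
    (∃ C : ℕ, ∀ (G : Type u) [Group G] (N : Subgroup G) [N.Normal] [Finite N],
      (TwinWidth.utww G < ⊤ ↔ TwinWidth.utww (G ⧸ N) < ⊤) ∧
      TwinWidth.utww G ≤ max (TwinWidth.utww (G ⧸ N)) (Nat.card N : ℕ∞) ∧
      (Nat.card N = 1 → TwinWidth.utww (G ⧸ N) = TwinWidth.utww G) ∧
      (2 ≤ Nat.card N → ∀ k : ℕ, TwinWidth.utww G = (k : ℕ∞) →
        TwinWidth.utww (G ⧸ N) ≤ ((2 ^ (Nat.card N ^ (C * Nat.card N * k)) : ℕ) : ℕ∞))) ∧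
    -- (6) Complete and restricted wreath products.
    (∀ (G : Type u) (H : Type v) [Group G] [Group H],
      TwinWidth.utww (TwinWidth.WreathProduct G H) =
        max (TwinWidth.utww G) (TwinWidth.utww H) ∧
      TwinWidth.utww (TwinWidth.restrictedWreathProduct G H) =
        max (TwinWidth.utww G) (TwinWidth.utww H)) := by
  refine ⟨fun G _ H => TwinWidth.utww_le_max_cosets H,
    fun N E Q _ _ _ S => TwinWidth.utww_extension_le S,
    fun G H _ _ φ => TwinWidth.utww_semidirectProduct φ,
    fun G H _ _ => TwinWidth.utww_prod G H,
    fun ι _ G _ => ⟨TwinWidth.utww_pi G, TwinWidth.utww_directSum G⟩,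
    fun G _ ι K hK hG => TwinWidth.utww_union K hK hG,
    fun G _ H _ => ⟨TwinWidth.utww_subgroup_le H, TwinWidth.utww_le_max_index H⟩,
    ⟨25, fun G _ N _ _ => ?_⟩,
    fun G H _ _ => ⟨TwinWidth.utww_wreathProduct G H, TwinWidth.utww_restrictedWreathProduct G H⟩⟩
  have hmax : TwinWidth.utww G ≤ max (TwinWidth.utww (G ⧸ N)) (Nat.card N : ℕ∞) := by
    rw [← ENat.card_eq_coe_natCard]
    exact TwinWidth.utww_le_max_quotient N
  refine ⟨⟨fun hG => ?_, fun hQ => hmax.trans_lt (max_lt hQ (ENat.natCast_lt_top _))⟩, hmax,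
    TwinWidth.utww_quotient_eq_of_card_eq_one N, fun ht k hk => TwinWidth.utww_quotient_le N ht hk⟩
  obtain ⟨k, hk⟩ := ENat.ne_top_iff_exists.1 hG.ne
  -- The explicit bound needs `|N| ≥ 2`; for trivial `N` the quotient map is an isomorphism.
  rcases Nat.lt_or_ge (Nat.card N) 2 with h | h
  · rw [TwinWidth.utww_quotient_eq_of_card_eq_one N (by have := Nat.card_pos (α := N); omega)]
    exact hG
  · exact (TwinWidth.utww_quotient_le N h hk.symm).trans_lt (ENat.natCast_lt_top _)
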